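/- Fix a vocabulary with one binary relation symbol $R$ and a countably infinite set of proposition letters. A Kripke model is $M=(W,R,V)$ with $R\subseteq W\times W$ and $V(p)\subseteq W$ for each letter $p$; a pointed model is a pair $(M,w)$ with $w\in W$. An abstract modal logic is a pair $\mathcal L=(\mathsf{Fml}_{\mathcal L},\models_{\mathcal L})$ of a set of formulas and a relation between formulas and pointed Kripke models that is invariant under isomorphism of pointed models and closed under * Boolean connectives: negations and conjunctions of formulas are expressible; * renaming: for every map $\rho$ from letters to letters and every $\varphi$ there is $\psi$ such that $(M,w)\models\psi$ iff $(\rho(M),w)\models\varphi$ for all $(M,w)$, where $\rho(M)$ has the worlds and relation of $M$ and interprets each letter $p$ as $V(\rho(p))$; * relativisation: for every letter $p$ and every $\varphi$ there is $\psi$ such that, for all $(M,w)$ with $w\in V(p)$, $(M,w)\models\psi$ iff $(M^p,w)\models\varphi$, where $M^p$ is the submodel of $M$ induced by $V(p)$. We say that $\mathcal L'$ extends $\mathcal L$, or that $\mathcal L$ is no more expressive than $\mathcal L'$, if there is a map $f:\mathsf{Fml}_{\mathcal L}\to\mathsf{Fml}_{\mathcal L'}$ such that $(M,w)\models_{\mathcal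 L}\varphi$ iff $(M,w)\models_{\mathcal L'}f(\varphi)$ for all $\varphi$ and all $(M,w)$. Graded modal logic $GML$ is the abstract modal logic with formulas $\varphi::=p\mid\neg\varphi\mid\varphi\wedge\psi\mid\Diamond_k\varphi$ ($p$ a letter, $k\in\mathbb N$), where $(M,w)\models\Diamond_k\varphi$ iff at least $k$ worlds $v$ with $wRv$ satisfy $(M,v)\models\varphi$, and the other clauses are as usual. The tree unraveling $\mathsf{unr}(M,w)$ has as worlds all finite sequences $\langle w_1,\dots,w_n\rangle$, $n\ge1$, with $w_1=w$ and $w_iRw_{i+1}$ for $1\le i<n$; its relation consists of all pairs $(\langle w_1,\dots,w_n\rangle,\langle w_1,\dots,w_n,w_{n+1}\rangle)$ of worlds, and $\langle w_1,\dots,w_n\rangle\in V'(p)$ iff $w_n\in V(p)$. **Theorem.** Let $\mathcal L$ be an abstract modal logic extending $GML$. Then $\mathcal L$ is no more expressive than $GML$ if and only if $\mathcal L$ has all three of the following properties: 1. Invariance for tree unravelings: $(M,w)\models\varphi$ iff $(\mathsf{unr}(M,w),\langle w\rangle)\models\varphi$, for every formula $\varphi$ of $\mathcal L$ and every pointed Kripke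 model $(M,w)$. 2. Compactness: every set of $\mathcal L$-formulas all of whose finite subsets are satisfiable is satisfiable, where a set is satisfiable if all its members are true at a common pointed model. 3. Löwenheim–Skolem property: every satisfiable set of $\mathcal L$-formulas is satisfied at a point of a Kripke model with a countable (finite or countably infinite) domain. -/

import Mathlib

universe u v w

/-- A Kripke model for the vocabulary with one binary relation symbol and
countably many proposition letters, indexed by `ℕ`. -/
structure KripkeModel where
  World : Type u
  Rel : World → World → Prop
  Val : ℕ → World → Prop

namespace KripkeModel

/-- Isomorphisms of Kripke models. -/
structure Iso (M N : KripkeModel.{u}) where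
  toEquiv : M.World ≃ N.World
  rel_iff : ∀ x y, N.Rel (toEquiv x) (toEquiv y) ↔ M.Rel x y
  val_iff : ∀ p x, N.Val p (toEquiv x) ↔ M.Val p x

/-- The model in which a letter `p` is interpreted as `M` interprets the letter `ρ p`. -/
abbrev rename (ρ : ℕ → ℕ) (M : KripkeModel.{u}) : KripkeModel.{u} where
  World := M.World
  Rel := M.Rel
  Val p := M.Val (ρ p)

/-- The submodel of `M` induced by the set of worlds satisfying the letter `p`. -/
abbrev relativize (M : KripkeModel.{u}) (p : ℕ) : KripkeModel.{u} where
  World := {x : M.World // M.Val p x}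
  Rel x y := M.Rel x.1 y.1
  Val q x := M.Val q x.1

/-- The tree unraveling of `M` at `a`: its worlds are the finite paths `⟨a, x₂, …, xₙ⟩`
along the relation of `M`, a path is related to its one-step extensions, and a letter is
true at a path if it is true at the last world of the path. -/
abbrev unravel (M : KripkeModel.{u}) (a : M.World) : KripkeModel.{u} where
  World := {l : List M.World // l.head? = some a ∧ l.IsChain M.Rel}
  Rel s t := ∃ x, t.1 = s.1 ++ [x]
  Val p s := ∃ x, s.1.getLast? = some x ∧ M.Val p x

/-- The root `⟨a⟩` of the tree unraveling. -/
def unravelRoot (M : KripkeModel.{u}) (a : M.World) : (M.unravel a).World :=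
  ⟨[a], rfl, List.isChain_singleton a⟩

end KripkeModel

set_option linter.checkUnivs false in
/-- Abstract modal logics: a type of formulas with a truth relation between formulas and
pointed Kripke models that is invariant under isomorphism and closed under the Boolean
connectives, renaming of proposition letters, and relativisation by proposition letters.
A formula expresses the relativisation of `φ` by `p` if it is evaluated, at the pointed
models `(M, a)` for which `a` belongs to the submodel induced by `p`, as `φ` is
evaluated at `a` in that submodel. -/
structure AbstractModalLogic where
  Fml : Type v
  Sat : Fml → (M : KripkeModel.{u}) → M.World → Prop
  iso_invariant : ∀ (φ : Fml) (M N : KripkeModel.{u}) (e : M.Iso N) (a : M.World),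
    Sat φ M a ↔ Sat φ N (e.toEquiv a)
  closed_neg : ∀ φ : Fml, ∃ ψ : Fml, ∀ (M : KripkeModel.{u}) (a : M.World),
    Sat ψ M a ↔ ¬ Sat φ M a
  closed_and : ∀ φ ψ : Fml, ∃ χ : Fml, ∀ (M : KripkeModel.{u}) (a : M.World),
    Sat χ M a ↔ (Sat φ M a ∧ Sat ψ M a)
  closed_rename : ∀ (ρ : ℕ → ℕ) (φ : Fml), ∃ ψ : Fml, ∀ (M : KripkeModel.{u}) (a : M.World),
    Sat ψ M a ↔ Sat φ (M.rename ρ) a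
  closed_relativize : ∀ (p : ℕ) (φ : Fml), ∃ ψ : Fml, ∀ (M : KripkeModel.{u}) (a : M.World)
    (ha : M.Val p a), Sat ψ M a ↔ Sat φ (M.relativize p) ⟨a, ha⟩

namespace AbstractModalLogic

/-- `L` is contained in `L'`: there is a truth-preserving map from the formulas of `L` to
those of `L'`. Equivalently, `L'` extends `L`, or `L` is no more expressive than `L'`. -/
def ContainedIn (L : AbstractModalLogic.{u, v}) (L' : AbstractModalLogic.{u, w}) : Prop :=
  ∃ f : L.Fml → L'.Fml, ∀ (φ : L.Fml) (M : KripkeModel.{u}) (a : M.World),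
    L.Sat φ M a ↔ L'.Sat (f φ) M a

/-- `L'` extends `L`. -/
def Extends (L' : AbstractModalLogic.{u, w}) (L : AbstractModalLogic.{u, v}) : Prop :=
  L.ContainedIn L'

/-- A set of formulas is satisfiable if all its members hold at a common pointed model. -/
def Satisfiable (L : AbstractModalLogic.{u, v}) (S : Set L.Fml) : Prop :=
  ∃ (M : KripkeModel.{u}) (a : M.World), ∀ φ ∈ S, L.Sat φ M a

/-- Compactness. -/
def Compactness (L : AbstractModalLogic.{u, v}) : Prop :=
  ∀ S : Set L.Fml, (∀ F ⊆ S, F.Finite → L.Satisfiable F) → L.Satisfiable S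

/-- The Löwenheim–Skolem property: every satisfiable set of formulas has a countable
model. -/
def LowenheimSkolem (L : AbstractModalLogic.{u, v}) : Prop :=
  ∀ S : Set L.Fml, L.Satisfiable S →
    ∃ (M : KripkeModel.{u}) (a : M.World), Countable M.World ∧ ∀ φ ∈ S, L.Sat φ M a

/-- Invariance for tree unravelings. -/
def UnravelingInvariant (L : AbstractModalLogic.{u, v}) : Prop :=
  ∀ (φ : L.Fml) (M : KripkeModel.{u}) (a : M.World),
    L.Sat φ M a ↔ L.Sat φ (M.unravel a) (M.unravelRoot a)

end AbstractModalLogic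

/-- Formulas of graded modal logic. The formula `dia k φ` says that at least `k`
successors satisfy `φ`; the basic modality is `dia 1`. -/
inductive GMLFormula : Type where
  | letter : ℕ → GMLFormula
  | neg : GMLFormula → GMLFormula
  | and : GMLFormula → GMLFormula → GMLFormula
  | dia : ℕ → GMLFormula → GMLFormula

namespace GMLFormula

/-- Truth of graded modal formulas at a world of a Kripke model. -/
def Sat : GMLFormula → (M : KripkeModel.{u}) → M.World → Prop
  | letter p, M, a => M.Val p a
  | neg φ, M, a => ¬ Sat φ M a
  | and φ ψ, M, a => Sat φ M a ∧ Sat ψ M a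
  | dia k φ, M, a =>
      ∃ s : Finset M.World, s.card = k ∧ ∀ b ∈ s, M.Rel a b ∧ Sat φ M b

/-- Replacement of every proposition letter `p` by `ρ p`. -/
def rename (ρ : ℕ → ℕ) : GMLFormula → GMLFormula
  | letter p => letter (ρ p)
  | neg φ => neg (rename ρ φ)
  | and φ ψ => and (rename ρ φ) (rename ρ ψ)
  | dia k φ => dia k (rename ρ φ)

/-- Syntactic relativisation by the letter `p`. -/
def relativize (p : ℕ) : GMLFormula → GMLFormula
  | letter q => letter q
  | neg φ => neg (relativize p φ)
  | and φ ψ => and (relativize p φ) (relativize p ψ)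
  | dia k φ => dia k (and (letter p) (relativize p φ))

theorem sat_iso (φ : GMLFormula) (M N : KripkeModel.{u}) (e : M.Iso N) (a : M.World) :
    Sat φ M a ↔ Sat φ N (e.toEquiv a) := by
  induction φ generalizing a with
  | letter p => exact (e.val_iff p a).symm
  | neg φ ih => exact not_congr (ih a)
  | and φ ψ ih₁ ih₂ => exact and_congr (ih₁ a) (ih₂ a)
  | dia k φ ih =>
    constructor
    · rintro ⟨s, hs, h⟩
      refine ⟨s.map e.toEquiv.toEmbedding, by simpa using hs, ?_⟩
      intro b hb
      obtain ⟨c, hc, rfl⟩ := Finset.mem_map.1 hb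
      exact ⟨(e.rel_iff a c).2 (h c hc).1, (ih c).1 (h c hc).2⟩
    · rintro ⟨s, hs, h⟩
      refine ⟨s.map e.toEquiv.symm.toEmbedding, by simpa using hs, ?_⟩
      intro b hb
      obtain ⟨c, hc, rfl⟩ := Finset.mem_map.1 hb
      obtain ⟨h₁, h₂⟩ := h c hc
      constructor
      · rw [← e.rel_iff]
        simpa using h₁
      · rw [ih]
        simpa using h₂

theorem sat_rename (ρ : ℕ → ℕ) (φ : GMLFormula) (M : KripkeModel.{u}) (a : M.World) :
    Sat (rename ρ φ) M a ↔ Sat φ (M.rename ρ) a := by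
  induction φ generalizing a with
  | letter p => exact Iff.rfl
  | neg φ ih => exact not_congr (ih a)
  | and φ ψ ih₁ ih₂ => exact and_congr (ih₁ a) (ih₂ a)
  | dia k φ ih =>
    exact exists_congr fun s => and_congr Iff.rfl
      (forall₂_congr fun b _ => and_congr Iff.rfl (ih b))

theorem sat_relativize (p : ℕ) (φ : GMLFormula) (M : KripkeModel.{u}) (a : M.World)
    (ha : M.Val p a) :
    Sat (relativize p φ) M a ↔ Sat φ (M.relativize p) ⟨a, ha⟩ := by
  induction φ generalizing a with
  | letter q => exact Iff.rfl
  | neg φ ih => exact not_congr (ih a ha)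
  | and φ ψ ih₁ ih₂ => exact and_congr (ih₁ a ha) (ih₂ a ha)
  | dia k φ ih =>
    classical
    constructor
    · rintro ⟨s, hs, h⟩
      have hp : ∀ b ∈ s, M.Val p b := fun b hb => (h b hb).2.1
      refine ⟨s.attach.map ⟨fun b => (⟨b.1, hp b.1 b.2⟩ : {x // M.Val p x}), ?_⟩,
        (Finset.card_map _).trans (Finset.card_attach.trans hs), ?_⟩
      · intro b c hbc
        exact Subtype.ext (Subtype.mk.inj hbc)
      · intro b hb
        obtain ⟨c, -, rfl⟩ := Finset.mem_map.1 hb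
        exact ⟨(h c.1 c.2).1, (ih c.1 (hp c.1 c.2)).1 (h c.1 c.2).2.2⟩
    · rintro ⟨s, hs, h⟩
      refine ⟨s.map ⟨Subtype.val, Subtype.val_injective⟩,
        (Finset.card_map _).trans hs, ?_⟩
      intro b hb
      obtain ⟨c, hc, rfl⟩ := Finset.mem_map.1 hb
      exact ⟨(h c hc).1, c.2, (ih c.1 c.2).2 (h c hc).2⟩

end GMLFormula

/-- Graded modal logic as an abstract modal logic. -/
def GML : AbstractModalLogic.{u, 0} where
  Fml := GMLFormula
  Sat := GMLFormula.Sat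
  iso_invariant := GMLFormula.sat_iso
  closed_neg φ := ⟨φ.neg, fun _ _ => Iff.rfl⟩
  closed_and φ ψ := ⟨φ.and ψ, fun _ _ => Iff.rfl⟩
  closed_rename ρ φ := ⟨φ.rename ρ, GMLFormula.sat_rename ρ φ⟩
  closed_relativize p φ := ⟨φ.relativize p, GMLFormula.sat_relativize p φ⟩

/-! `GML` is invariant under graded bisimulations, and its standard translation into first-order
logic with a constant for the point transfers compactness and Löwenheim–Skolem to it and to any
logic it contains.

For the converse, unraveling invariance gives invariance under graded bisimulations. The aim is that
each `φ` of `L` is invariant under equivalence in `GML`; compactness then makes `φ` equivalent to a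
single graded formula. `GradedEquiv M N d` interpolates: `d` rounds of bijections between
successors, ending in pairs of `GML`-equivalent worlds.

Bounded depth (`exists_depth`): if for every `d` some models related at depth `d` disagree on `φ`,
glue each such pair into one model whose first `d` levels are common to two submodels, marked by the
letters `0` and `1`. By compactness some model has two marked parts that coincide on everything
reachable and still disagree on `φ`, which is absurd.

Descent (`sat_of_gradedEquiv_succ`): preservation at depth `d + 1` implies it at depth `d`, so `d`
can be lowered to `0`. Let `M`, `N` be related at depth `d` and disagree on `φ`. For a finite set
`s` of graded formulas, sort the worlds at level `d + 1` into classes by the members of `s` they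
satisfy, and pass from `M` to `N` by replacing one class at a time. Some single replacement changes
`φ`; glue the models before and after it. The exchanged children agree on `s`, and graded formulas
cannot tell their numbers apart. Compactness over `s` and Löwenheim–Skolem give a countable model in
which the exchanged children all satisfy the same graded formulas and are equally many, so its parts
are related at depth `d + 1` and disagree on `φ`. -/

theorem exists_equiv_of_existsUnique {X : Type*} {Y : Type*} (r : X → Y → Prop)
    (hX : ∀ x, ∃! y, r x y) (hY : ∀ y, ∃! x, r x y) : ∃ e : X ≃ Y, ∀ x, r x (e x) := by
  choose f hf hf' using hX
  choose g hg hg' using hY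
  exact ⟨⟨f, g, fun x => (hg' _ _ (hf x)).symm, fun y => (hf' _ _ (hg y)).symm⟩, hf⟩

/-! ### Graded bisimulations, covering maps and isomorphic unravelings. -/

namespace KripkeModel

/-- A graded bisimulation in the strong sense: related worlds satisfy the same letters, and
there is a bijection between their successors that relates successors to their images. -/
def IsGradedBisim (M N : KripkeModel.{u}) (Z : M.World → N.World → Prop) : Prop :=
  ∀ x y, Z x y → (∀ p, M.Val p x ↔ N.Val p y) ∧
    ∃ e : {x' // M.Rel x x'} ≃ {y' // N.Rel y y'}, ∀ x', Z x'.1 (e x').1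

/-- Covering maps preserve letters and are bijective on successors. -/
structure IsCover {M N : KripkeModel.{u}} (f : M.World → N.World) : Prop where
  val_iff : ∀ p x, N.Val p (f x) ↔ M.Val p x
  rel : ∀ x x', M.Rel x x' → N.Rel (f x) (f x')
  lift : ∀ x y', N.Rel (f x) y' → ∃ x', M.Rel x x' ∧ f x' = y'
  inj : ∀ x x' x'', M.Rel x x' → M.Rel x x'' → f x' = f x'' → x' = x''

namespace IsCover

variable {M N : KripkeModel.{u}} {f : M.World → N.World}

theorem isChain_map (hf : IsCover f) {l : List M.World} (hl : l.IsChain M.Rel) :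
    (l.map f).IsChain N.Rel :=
  (List.isChain_map f).2 (hl.imp hf.rel)

theorem map_injective (hf : IsCover f) (a : M.World) (l l' : List M.World)
    (hl : (a :: l).IsChain M.Rel) (hl' : (a :: l').IsChain M.Rel)
    (h : l.map f = l'.map f) : l = l' := by
  induction l generalizing a l' with
  | nil => simpa using h.symm
  | cons b l ih =>
    cases l' with
    | nil => simp at h
    | cons b' l' =>
      rw [List.map_cons, List.map_cons, List.cons.injEq] at h
      rw [List.isChain_cons_cons] at hl hl'
      obtain rfl := hf.inj a b b' hl.1 hl'.1 h.1
      rw [ih b l' hl.2 hl'.2 h.2]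

theorem exists_map_eq (hf : IsCover f) (a : M.World) (l : List N.World)
    (hl : (f a :: l).IsChain N.Rel) :
    ∃ l' : List M.World, (a :: l').IsChain M.Rel ∧ l'.map f = l := by
  induction l generalizing a with
  | nil => exact ⟨[], List.isChain_singleton a, rfl⟩
  | cons b l ih =>
    rw [List.isChain_cons_cons] at hl
    obtain ⟨b', hb', rfl⟩ := hf.lift a b hl.1
    obtain ⟨l', hl', rfl⟩ := ih b' hl.2
    exact ⟨b' :: l', List.isChain_cons_cons.2 ⟨hb', hl'⟩, rfl⟩

/-- The map on unravelings induced by a covering map. -/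
def unravelMap (hf : IsCover f) (a : M.World) (s : (M.unravel a).World) :
    (N.unravel (f a)).World :=
  ⟨s.1.map f, by rw [List.head?_map, s.2.1]; rfl, hf.isChain_map s.2.2⟩

theorem eq_of_map_eq (hf : IsCover f) {a : M.World} {s t : List M.World}
    (hs : s.head? = some a ∧ s.IsChain M.Rel) (ht : t.head? = some a ∧ t.IsChain M.Rel)
    (h : s.map f = t.map f) : s = t := by
  obtain ⟨hs, hs'⟩ := hs
  obtain ⟨ht, ht'⟩ := ht
  obtain ⟨s, rfl⟩ := List.head?_eq_some_iff.1 hs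
  obtain ⟨t, rfl⟩ := List.head?_eq_some_iff.1 ht
  rw [List.map_cons, List.map_cons, List.cons.injEq] at h
  rw [hf.map_injective a s t hs' ht' h.2]

/-- Paths lift uniquely along a covering map once the starting world is fixed. -/
theorem unravelMap_bijective (hf : IsCover f) (a : M.World) :
    Function.Bijective (hf.unravelMap a) := by
  constructor
  · intro s t h
    exact Subtype.ext (hf.eq_of_map_eq s.2 t.2 (congrArg Subtype.val h))
  · rintro ⟨l, hl, hl'⟩
    obtain ⟨l, rfl⟩ := List.head?_eq_some_iff.1 hl
    obtain ⟨l', h, rfl⟩ := hf.exists_map_eq a l hl'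
    exact ⟨⟨a :: l', rfl, h⟩, rfl⟩

/-- A covering map induces an isomorphism of unravelings. -/
noncomputable def unravelIso (hf : IsCover f) (a : M.World) :
    (M.unravel a).Iso (N.unravel (f a)) where
  toEquiv := Equiv.ofBijective _ (hf.unravelMap_bijective a)
  rel_iff := by
    rintro ⟨s, hs⟩ ⟨t, ht⟩
    constructor
    · rintro ⟨x, hx⟩
      change t.map f = s.map f ++ [x] at hx
      obtain ⟨t₁, t₂, rfl, h₁, h₂⟩ := List.map_eq_append_iff.1 hx
      obtain ⟨z, t₃, rfl, -, h₃⟩ := List.map_eq_cons_iff.1 h₂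
      obtain rfl := List.map_eq_nil_iff.1 h₃
      refine ⟨z, ?_⟩
      have hne : t₁ ≠ [] := by
        rintro rfl
        rw [List.map_nil, eq_comm, List.map_eq_nil_iff] at h₁
        simp [h₁] at hs
      refine congrArg (· ++ [z]) (hf.eq_of_map_eq (a := a) ⟨?_, ht.2.left_of_append⟩ hs h₁)
      rw [← ht.1, List.head?_append_of_ne_nil _ hne]
    · rintro ⟨x, hx⟩
      refine ⟨f x, ?_⟩
      change t.map f = s.map f ++ [f x]
      change t = s ++ [x] at hx
      rw [hx, List.map_append]
      rfl
  val_iff := by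
    rintro p ⟨s, hs⟩
    change (∃ x, (s.map f).getLast? = some x ∧ N.Val p x) ↔ ∃ x, s.getLast? = some x ∧ M.Val p x
    rw [List.getLast?_map]
    simp [hf.val_iff]

end IsCover

end KripkeModel

/-! ### From unraveling invariance to invariance under graded bisimulations. -/

namespace AbstractModalLogic

open KripkeModel

variable {L : AbstractModalLogic.{u, v}}

theorem UnravelingInvariant.sat_cover (hU : L.UnravelingInvariant) {M N : KripkeModel.{u}}
    {f : M.World → N.World} (hf : IsCover f) (φ : L.Fml) (a : M.World) :
    L.Sat φ M a ↔ L.Sat φ N (f a) := by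
  rw [hU φ M a, hU φ N (f a), L.iso_invariant φ _ _ (hf.unravelIso a)]
  rfl

/-- Formulas that are invariant for unravelings are invariant for graded bisimulations. -/
theorem UnravelingInvariant.sat_bisim (hU : L.UnravelingInvariant) {M N : KripkeModel.{u}}
    {Z : M.World → N.World → Prop} (hZ : M.IsGradedBisim N Z) (φ : L.Fml) {a : M.World}
    {b : N.World} (hab : Z a b) : L.Sat φ M a ↔ L.Sat φ N b := by
  choose hval e he using hZ
  -- The relation `Z` itself becomes a model covering both sides: a step moves to a successor and to
  -- its image under the bijection chosen for the current pair.
  let Q : KripkeModel.{u} :=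
    { World := {x : M.World × N.World // Z x.1 x.2}
      Rel := fun s t => ∃ h : M.Rel s.1.1 t.1.1, (e _ _ s.2 ⟨_, h⟩).1 = t.1.2
      Val := fun p s => M.Val p s.1.1 }
  have h₁ : IsCover (M := Q) (N := M) fun s => s.1.1 := by
    refine ⟨fun _ _ => Iff.rfl, fun _ _ h => h.1, fun s x h => ?_, ?_⟩
    · exact ⟨⟨(x, (e _ _ s.2 ⟨x, h⟩).1), he _ _ s.2 ⟨x, h⟩⟩, ⟨h, rfl⟩, rfl⟩
    · rintro s ⟨⟨x, y⟩, ht⟩ ⟨⟨x', y'⟩, ht'⟩ ⟨h, hy⟩ ⟨h', hy'⟩ hx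
      dsimp only at hx hy hy'
      subst hx
      obtain rfl : y = y' := hy.symm.trans hy'
      rfl
  have h₂ : IsCover (M := Q) (N := N) fun s => s.1.2 := by
    refine ⟨fun p s => (hval _ _ s.2 p).symm, ?_, fun s y h => ?_, ?_⟩
    · rintro s ⟨⟨x, y⟩, ht⟩ ⟨h, hy⟩
      have := (e _ _ s.2 ⟨x, h⟩).2
      rwa [show (e _ _ s.2 ⟨x, h⟩).1 = y from hy] at this
    · let x := (e _ _ s.2).symm ⟨y, h⟩
      have hx : e _ _ s.2 x = ⟨y, h⟩ := Equiv.apply_symm_apply _ _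
      refine ⟨⟨(x.1, y), ?_⟩, ⟨x.2, congrArg Subtype.val hx⟩, rfl⟩
      have := he _ _ s.2 x
      rwa [hx] at this
    · rintro s ⟨⟨x, y⟩, ht⟩ ⟨⟨x', y'⟩, ht'⟩ ⟨h, hy⟩ ⟨h', hy'⟩ heq
      dsimp only at heq hy hy'
      subst heq
      have := Subtype.ext (hy.trans hy'.symm)
      have := congrArg Subtype.val ((e _ _ s.2).injective this)
      dsimp only at this
      subst this
      rfl
  exact (hU.sat_cover h₁ φ ⟨(a, b), hab⟩).symm.trans (hU.sat_cover h₂ φ ⟨(a, b), hab⟩)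

end AbstractModalLogic

/-! ### Bisimulation and unraveling invariance of graded modal logic. -/

namespace GMLFormula

open KripkeModel

theorem sat_dia_iff_subtype (k : ℕ) (φ : GMLFormula) (M : KripkeModel.{u}) (a : M.World) :
    Sat (dia k φ) M a ↔ ∃ s : Finset {b // M.Rel a b ∧ Sat φ M b}, s.card = k := by
  classical
  constructor
  · rintro ⟨s, hs, h⟩
    exact ⟨s.attach.map ⟨fun b => ⟨b.1, h b.1 b.2⟩,
      fun b c hbc => Subtype.ext (congrArg (fun z => z.1) hbc)⟩, by simpa using hs⟩
  · rintro ⟨s, hs⟩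
    refine ⟨s.map ⟨Subtype.val, Subtype.val_injective⟩, by simpa using hs, ?_⟩
    intro b hb
    obtain ⟨c, -, rfl⟩ := Finset.mem_map.1 hb
    exact c.2

theorem sat_dia_congr {k : ℕ} {φ ψ : GMLFormula} {M N : KripkeModel.{u}} {a : M.World}
    {b : N.World} (e : {x // M.Rel a x ∧ Sat φ M x} ≃ {y // N.Rel b y ∧ Sat ψ N y}) :
    Sat (dia k φ) M a ↔ Sat (dia k ψ) N b := by
  rw [sat_dia_iff_subtype, sat_dia_iff_subtype]
  constructor
  · rintro ⟨s, hs⟩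
    exact ⟨s.map e.toEmbedding, by simpa using hs⟩
  · rintro ⟨s, hs⟩
    exact ⟨s.map e.symm.toEmbedding, by simpa using hs⟩

theorem sat_bisim {M N : KripkeModel.{u}} {Z : M.World → N.World → Prop}
    (hZ : M.IsGradedBisim N Z) (φ : GMLFormula) {a : M.World} {b : N.World} (hab : Z a b) :
    Sat φ M a ↔ Sat φ N b := by
  induction φ generalizing a b with
  | letter p => exact (hZ a b hab).1 p
  | neg φ ih => exact not_congr (ih hab)
  | and φ ψ ih₁ ih₂ => exact and_congr (ih₁ hab) (ih₂ hab)
  | dia k φ ih =>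
    obtain ⟨-, e, he⟩ := hZ a b hab
    have h := e.subtypeEquiv (p := fun x => Sat φ M x.1) (q := fun y => Sat φ N y.1)
      fun x => ih (he x)
    exact sat_dia_congr ((Equiv.subtypeSubtypeEquivSubtypeInter _ (fun x => Sat φ M x)).symm.trans
      (h.trans (Equiv.subtypeSubtypeEquivSubtypeInter _ (fun y => Sat φ N y))))

end GMLFormula

/-- Sending a path to its last world is a graded bisimulation, since the successors of a path are
its one-step extensions. -/
theorem gml_unravelingInvariant : GML.{u}.UnravelingInvariant := by
  intro φ M a
  have hZ : (M.unravel a).IsGradedBisim M fun s x => s.1.getLast? = some x := by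
    intro s x hs
    refine ⟨fun p => ?_, ?_⟩
    · change (∃ x, s.1.getLast? = some x ∧ M.Val p x) ↔ _
      simp [hs]
    · obtain ⟨s₀, hs₀⟩ := List.getLast?_eq_some_iff.1 hs
      have hchain (y : M.World) (hy : M.Rel x y) :
          (s.1 ++ [y]).head? = some a ∧ (s.1 ++ [y]).IsChain M.Rel := by
        refine ⟨by rw [List.head?_append, s.2.1]; rfl, ?_⟩
        refine List.isChain_append.2 ⟨s.2.2, List.isChain_singleton y, ?_⟩
        intro x' hx' y' hy'
        rw [hs] at hx'
        simp only [Option.mem_def, Option.some.injEq, List.head?_cons] at hx' hy'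
        exact hx' ▸ hy' ▸ hy
      refine exists_equiv_of_existsUnique
        (fun (t : {t // (M.unravel a).Rel s t}) (y : {y // M.Rel x y}) =>
          t.1.1.getLast? = some y.1) ?_ ?_
      · rintro ⟨⟨t, ht⟩, y, hy⟩
        dsimp only at hy
        subst hy
        refine ⟨⟨y, ?_⟩, by simp, ?_⟩
        · exact (List.isChain_append.1 ht.2).2.2 x hs y rfl
        · rintro ⟨z, hz⟩ h
          simpa using h.symm
      · rintro ⟨y, hy⟩
        refine ⟨⟨⟨s.1 ++ [y], hchain y hy⟩, y, rfl⟩, by simp, ?_⟩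
        rintro ⟨⟨t, ht⟩, z, hz⟩ h
        dsimp only at hz
        subst hz
        simp only [List.getLast?_append, List.getLast?_singleton, Option.some_or,
          Option.some.injEq] at h
        subst h
        rfl
  exact (GMLFormula.sat_bisim hZ φ (a := M.unravelRoot a) rfl).symm

/-! ### Standard translation: compactness and Löwenheim–Skolem for graded modal logic. -/

open FirstOrder

namespace GMLFormula
namespace Standard

/-- Relation symbols: letters as unary predicates and the accessibility relation. -/
inductive Rels : ℕ → Type
  | letter (p : ℕ) : Rels 1
  | acc : Rels 2

/-- The only function symbol is a constant for the distinguished world. -/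
inductive Funcs : ℕ → Type
  | point : Funcs 0

instance (n : ℕ) : Countable (Rels n) := by
  refine Function.Injective.countable (β := Option ℕ)
    (f := fun r => match r with | .letter p => some p | .acc => none) ?_
  intro r s h
  cases r <;> cases s <;> simp_all

instance (n : ℕ) : Countable (Funcs n) := by
  refine Function.Injective.countable (β := Unit) (f := fun _ => ()) ?_
  intro r s h
  cases r; cases s; rfl

/-- The first-order language of pointed Kripke models. -/
def lang : FirstOrder.Language.{0, 0} := ⟨Funcs, Rels⟩

theorem card_lang_le : lang.card ≤ Cardinal.aleph0 := by
  have : Countable (Σ n, lang.Functions n) :=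
    inferInstanceAs (Countable (Σ n, Funcs n))
  have : Countable (Σ n, lang.Relations n) :=
    inferInstanceAs (Countable (Σ n, Rels n))
  have : Countable lang.Symbols := inferInstanceAs (Countable (_ ⊕ _))
  exact Cardinal.mk_le_aleph0

/-- The predicate symbol of a letter. -/
def letterSymbol (p : ℕ) : lang.Relations 1 := Rels.letter p

/-- The symbol of the accessibility relation. -/
def accSymbol : lang.Relations 2 := Rels.acc

/-- The constant symbol. -/
def pointSymbol : lang.Functions 0 := Funcs.point

/-- A pointed Kripke model as a first-order structure. -/
abbrev toStructure (M : KripkeModel.{u}) (a : M.World) : lang.Structure M.World where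
  funMap := fun {_} _ _ => a
  RelMap := fun {_} r => match r with
    | .letter p => fun x => M.Val p (x 0)
    | .acc => fun x => M.Rel (x 0) (x 1)

/-- A first-order structure as a Kripke model. -/
abbrev toModel (A : Type u) [lang.Structure A] : KripkeModel.{u} where
  World := A
  Rel x y := FirstOrder.Language.Structure.RelMap accSymbol ![x, y]
  Val p x := FirstOrder.Language.Structure.RelMap (letterSymbol p) ![x]

/-- The interpretation of the constant. -/
abbrev toPoint (A : Type u) [lang.Structure A] : A :=
  FirstOrder.Language.Structure.funMap pointSymbol ![]

/-- The standard translation, with one free variable. -/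
noncomputable def translate : GMLFormula → lang.Formula Unit
  | letter p => FirstOrder.Language.Relations.formula (letterSymbol p)
      ![FirstOrder.Language.Term.var ()]
  | neg φ => (translate φ).not
  | and φ ψ => translate φ ⊓ translate ψ
  | dia k φ => FirstOrder.Language.Formula.iExs (Fin k)
      (FirstOrder.Language.Formula.iInf (fun ij : {ij : Fin k × Fin k // ij.1 ≠ ij.2} =>
          (FirstOrder.Language.Term.equal (FirstOrder.Language.Term.var (Sum.inr ij.1.1))
            (FirstOrder.Language.Term.var (Sum.inr ij.1.2))).not) ⊓
        FirstOrder.Language.Formula.iInf fun i : Fin k =>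
          FirstOrder.Language.Relations.formula accSymbol
            ![FirstOrder.Language.Term.var (Sum.inl ()),
              FirstOrder.Language.Term.var (Sum.inr i)] ⊓
          (translate φ).relabel (fun _ => Sum.inr i))

theorem realize_translate (A : Type u) [lang.Structure A] (φ : GMLFormula) (v : Unit → A) :
    (translate φ).Realize v ↔ Sat φ (toModel A) (v ()) := by
  induction φ generalizing v with
  | letter p =>
    simp only [translate, FirstOrder.Language.Formula.realize_rel, Sat]
    refine iff_of_eq (congrArg _ (funext fun i => ?_))
    fin_cases i
    rfl
  | neg φ ih => exact not_congr (ih v)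
  | and φ ψ ih₁ ih₂ =>
    simp only [translate, FirstOrder.Language.Formula.realize_inf, ih₁, ih₂, Sat]
  | dia k φ ih =>
    have hrel (x : Fin k → A) (i : Fin k) :
        (FirstOrder.Language.Relations.formula accSymbol
          ![FirstOrder.Language.Term.var (Sum.inl ()),
            FirstOrder.Language.Term.var (Sum.inr i)]).Realize (Sum.elim v x) ↔
        (toModel A).Rel (v ()) (x i) := by
      rw [FirstOrder.Language.Formula.realize_rel]
      refine iff_of_eq (congrArg _ (funext fun j => ?_))
      fin_cases j <;> rfl
    simp only [translate, FirstOrder.Language.Formula.realize_iExs,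
      FirstOrder.Language.Formula.realize_inf, FirstOrder.Language.Formula.realize_iInf,
      FirstOrder.Language.Formula.realize_not, FirstOrder.Language.Formula.realize_equal,
      FirstOrder.Language.Formula.realize_relabel, hrel, ih, Sat,
      FirstOrder.Language.Term.realize_var, Sum.elim_inr, Function.comp_apply]
    constructor
    · rintro ⟨x, hx, h⟩
      have hinj : Function.Injective x := by
        intro i j hij
        by_contra hne
        exact hx ⟨(i, j), hne⟩ hij
      refine ⟨Finset.univ.map ⟨x, hinj⟩, by simp, ?_⟩
      intro b hb
      obtain ⟨i, -, rfl⟩ := Finset.mem_map.1 hb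
      exact h i
    · rintro ⟨s, rfl, h⟩
      refine ⟨fun i => (s.equivFin.symm i).1, ?_, fun i => h _ (s.equivFin.symm i).2⟩
      rintro ⟨⟨i, j⟩, hne⟩ hij
      exact hne (s.equivFin.symm.injective (Subtype.ext hij))

/-- The standard translation at the constant. -/
noncomputable def sentence (φ : GMLFormula) : lang.Sentence :=
  (translate φ).subst fun _ =>
    FirstOrder.Language.Term.func pointSymbol Fin.elim0

theorem realize_sentence (A : Type u) [lang.Structure A] (φ : GMLFormula) :
    A ⊨ sentence φ ↔ Sat φ (toModel A) (toPoint A) := by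
  rw [FirstOrder.Language.Sentence.Realize, FirstOrder.Language.Formula.Realize, sentence,
    FirstOrder.Language.BoundedFormula.realize_subst]
  refine (realize_translate A φ _).trans (iff_of_eq (congrArg _ ?_))
  exact congrArg (FirstOrder.Language.Structure.funMap pointSymbol)
    (Subsingleton.elim _ _)

end Standard

open Standard in
/-- A finitely satisfiable set of graded modal formulas has a countable model. -/
theorem exists_countable_model (S : Set GMLFormula)
    (hS : ∀ F ⊆ S, F.Finite → ∃ (M : KripkeModel.{u}) (a : M.World), ∀ φ ∈ F, Sat φ M a) :
    ∃ (M : KripkeModel.{u}) (a : M.World), Countable M.World ∧ ∀ φ ∈ S, Sat φ M a := by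
  classical
  have hsat : FirstOrder.Language.Theory.IsSatisfiable (sentence '' S) := by
    rw [FirstOrder.Language.Theory.isSatisfiable_iff_isFinitelySatisfiable]
    intro T hT
    obtain ⟨F, hFS, hFT⟩ := Finset.subset_set_image_iff.1 hT
    obtain ⟨M, a, hM⟩ := hS F hFS F.finite_toSet
    let _ := toStructure M a
    have : Nonempty M.World := ⟨a⟩
    have : M.World ⊨ (T : lang.Theory) := by
      refine ⟨fun σ hσ => ?_⟩
      rw [← hFT, Finset.coe_image] at hσ
      obtain ⟨φ, hφ, rfl⟩ := hσ
      rw [realize_sentence]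
      exact hM φ hφ
    exact FirstOrder.Language.Theory.Model.isSatisfiable M.World
  obtain ⟨A⟩ := hsat
  have key : ∃ B : lang.ElementarySubstructure A, Countable B := by
    -- The downward theorem yields a substructure of cardinality exactly `ℵ₀`, so a finite model is
    -- kept whole.
    rcases finite_or_infinite A with hA | hA
    · exact ⟨⊤, inferInstance⟩
    · obtain ⟨B, -, hB⟩ := FirstOrder.Language.exists_elementarySubstructure_card_eq lang
        (M := A) ∅ Cardinal.aleph0.{0} le_rfl (by simp) (by simpa using card_lang_le)
        (by simp)
      exact ⟨B, Cardinal.mk_le_aleph0_iff.1 (by simpa using hB.le)⟩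
  obtain ⟨B, hB⟩ := key
  have hBT (φ : GMLFormula) (hφ : φ ∈ S) : Sat φ (toModel B) (toPoint B) := by
    rw [← realize_sentence, B.realize_sentence]
    exact A.is_model.realize_of_mem _ (Set.mem_image_of_mem _ hφ)
  -- The first-order model lives in universe `0` and is lifted to the universe of the Kripke models.
  let _ : lang.Structure (ULift.{u} B) := Equiv.ulift.symm.inducedStructure
  have e : B ≃[lang] ULift.{u} B := Equiv.ulift.symm.inducedStructureEquiv
  refine ⟨toModel (ULift.{u} B), toPoint (ULift.{u} B), inferInstance, fun φ hφ => ?_⟩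
  rw [← realize_sentence, ← FirstOrder.Language.StrongHomClass.realize_sentence e, realize_sentence]
  exact hBT φ hφ

end GMLFormula

/-! ### Reachability, marked parts of a model, and approximate bisimilarity. -/

namespace GMLFormula

/-- Disjunction. -/
def or (φ ψ : GMLFormula) : GMLFormula := neg (and (neg φ) (neg ψ))

/-- Implication. -/
def imp (φ ψ : GMLFormula) : GMLFormula := neg (and φ (neg ψ))

/-- Equivalence. -/
def iff (φ ψ : GMLFormula) : GMLFormula := and (imp φ ψ) (imp ψ φ)

/-- The `n`-fold iteration of the box. -/
def box : ℕ → GMLFormula → GMLFormula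
  | 0, φ => φ
  | n + 1, φ => neg (dia 1 (neg (box n φ)))

end GMLFormula

namespace KripkeModel

/-- Reachability in exactly `n` steps. -/
def Reach (M : KripkeModel.{u}) : ℕ → M.World → M.World → Prop
  | 0, x, y => x = y
  | n + 1, x, y => ∃ z, M.Rel x z ∧ M.Reach n z y

theorem Reach.succ {M : KripkeModel.{u}} {n : ℕ} {x y z : M.World} (h : M.Reach n x y)
    (hyz : M.Rel y z) : M.Reach (n + 1) x z := by
  induction n generalizing x with
  | zero =>
    obtain rfl : x = y := h
    exact ⟨z, hyz, rfl⟩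
  | succ n ih =>
    obtain ⟨t, ht, h⟩ := h
    exact ⟨t, ht, ih h⟩

/-- The model obtained from the submodel induced by the letter `i` by reading the letter
`n + 2` as `n`. The letters `0` and `1` thus serve to mark two parts of a model. -/
abbrev part (M : KripkeModel.{u}) (i : ℕ) : KripkeModel.{u} :=
  (M.relativize i).rename (· + 2)

/-- Approximations of graded bisimilarity, starting from equivalence in graded modal
logic. -/
def GradedEquiv (M N : KripkeModel.{u}) : ℕ → M.World → N.World → Prop
  | 0, x, y => ∀ ψ : GMLFormula, ψ.Sat M x ↔ ψ.Sat N y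
  | d + 1, x, y => (∀ p, M.Val p x ↔ N.Val p y) ∧
      ∃ e : {x' // M.Rel x x'} ≃ {y' // N.Rel y y'}, ∀ x', GradedEquiv M N d x'.1 (e x').1

theorem GradedEquiv.val_iff {M N : KripkeModel.{u}} {d : ℕ} {x : M.World} {y : N.World}
    (h : GradedEquiv M N d x y) (p : ℕ) : M.Val p x ↔ N.Val p y := by
  cases d with
  | zero => exact h (.letter p)
  | succ d => exact h.1 p

end KripkeModel

namespace GMLFormula

open KripkeModel

variable {M : KripkeModel.{u}} {a : M.World} {φ ψ : GMLFormula}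

@[simp] theorem sat_neg : Sat (neg φ) M a ↔ ¬ Sat φ M a := Iff.rfl

@[simp] theorem sat_and : Sat (and φ ψ) M a ↔ Sat φ M a ∧ Sat ψ M a := Iff.rfl

@[simp] theorem sat_letter {p : ℕ} : Sat (letter p) M a ↔ M.Val p a := Iff.rfl

@[simp] theorem sat_or : Sat (or φ ψ) M a ↔ Sat φ M a ∨ Sat ψ M a := by
  simp only [or, sat_neg, sat_and]; tauto

@[simp] theorem sat_imp : Sat (imp φ ψ) M a ↔ (Sat φ M a → Sat ψ M a) := by
  simp only [imp, sat_neg, sat_and]; tauto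

@[simp] theorem sat_iff : Sat (iff φ ψ) M a ↔ (Sat φ M a ↔ Sat ψ M a) := by
  simp only [iff, sat_and, sat_imp]; tauto

@[simp] theorem sat_box {n : ℕ} : Sat (box n φ) M a ↔ ∀ b, M.Reach n a b → Sat φ M b := by
  induction n generalizing a with
  | zero => exact ⟨fun h b hb => by rwa [← show a = b from hb], fun h => h a rfl⟩
  | succ n ih =>
    have h₁ : Sat (box (n + 1) φ) M a ↔ ∀ b, M.Rel a b → Sat (box n φ) M b := by
      constructor
      · intro h b hb
        by_contra hn
        exact h ⟨{b}, rfl, fun c hc => by rw [Finset.mem_singleton.1 hc]; exact ⟨hb, hn⟩⟩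
      · rintro h ⟨s, hs, hs'⟩
        obtain ⟨b, rfl⟩ := Finset.card_eq_one.1 hs
        have := hs' b (Finset.mem_singleton_self b)
        exact this.2 (h b this.1)
    rw [h₁]
    simp only [ih, Reach]
    exact ⟨fun h b ⟨c, hc, hcb⟩ => h c hc b hcb, fun h c hc b hcb => h b ⟨c, hc, hcb⟩⟩

/-- The formula that expresses truth in the part marked by the letter `i`. -/
def onPart (i : ℕ) (ψ : GMLFormula) : GMLFormula := (ψ.rename (· + 2)).relativize i

theorem sat_onPart {i : ℕ} (h : M.Val i a) :
    Sat (onPart i ψ) M a ↔ Sat ψ (M.part i) ⟨a, h⟩ := by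
  rw [onPart, sat_relativize i _ M a h, sat_rename]

theorem exists_class_formula (s e : Finset GMLFormula) :
    ∃ χ : GMLFormula, ∀ (M : KripkeModel.{u}) (a : M.World),
      Sat χ M a ↔ ∀ ψ ∈ s, (Sat ψ M a ↔ ψ ∈ e) := by
  classical
  induction s using Finset.induction_on with
  | empty => exact ⟨imp (letter 0) (letter 0), fun M a => by simp⟩
  | insert ψ s _ ih =>
    obtain ⟨χ, hχ⟩ := ih
    by_cases h : ψ ∈ e
    · exact ⟨and ψ χ, fun M a => by simp [hχ, h]⟩
    · exact ⟨and (neg ψ) χ, fun M a => by simp [hχ, h]⟩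

theorem exists_conj (s : Finset GMLFormula) :
    ∃ χ : GMLFormula, ∀ (M : KripkeModel.{u}) (a : M.World),
      Sat χ M a ↔ ∀ ψ ∈ s, Sat ψ M a := by
  obtain ⟨χ, hχ⟩ := exists_class_formula s s
  exact ⟨χ, fun M a => (hχ M a).trans (forall₂_congr fun ψ h => by simp [h])⟩

end GMLFormula

/-! ### Hybrids of two models, and gluing two hybrids into one model. -/

namespace KripkeModel

/-- The worlds of a glued model: copies of pairs of worlds with a countdown, and copies of
the worlds of both models that carry a tag. -/
inductive GlueWorld (T : Type) (A B : Type u) : Type u where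
  | pair (k : ℕ) (x : A) (y : B)
  | left (t : T) (x : A)
  | right (t : T) (y : B)

variable {M N : KripkeModel.{u}}

/-- The bijection between successors that witnesses `GradedEquiv` maps `x'` to `y'`. -/
def Matched (M N : KripkeModel.{u}) (k : ℕ) (x : M.World) (y : N.World) (x' : M.World)
    (y' : N.World) : Prop :=
  ∃ (h : GradedEquiv M N (k + 1) x y) (hx : M.Rel x x'), (h.2.choose ⟨x', hx⟩).1 = y'

section Matched

variable {k : ℕ} {x x' : M.World} {y y' : N.World}

theorem Matched.gradedEquiv (h : Matched M N k x y x' y') : GradedEquiv M N k x' y' := by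
  obtain ⟨h, hx, rfl⟩ := h
  exact h.2.choose_spec ⟨x', hx⟩

theorem Matched.rel_left (h : Matched M N k x y x' y') : M.Rel x x' := h.2.1

theorem Matched.rel_right (h : Matched M N k x y x' y') : N.Rel y y' := by
  obtain ⟨h, hx, rfl⟩ := h
  exact (h.2.choose ⟨x', hx⟩).2

theorem existsUnique_matched_right (h : GradedEquiv M N (k + 1) x y) (hx : M.Rel x x') :
    ∃! y', Matched M N k x y x' y' :=
  ⟨_, ⟨h, hx, rfl⟩, fun _ ⟨_, _, h⟩ => h.symm⟩

theorem existsUnique_matched_left (h : GradedEquiv M N (k + 1) x y) (hy : N.Rel y y') :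
    ∃! x', Matched M N k x y x' y' := by
  refine ⟨(h.2.choose.symm ⟨y', hy⟩).1, ⟨h, (h.2.choose.symm ⟨y', hy⟩).2, ?_⟩, ?_⟩
  · exact congrArg Subtype.val (h.2.choose.apply_symm_apply ⟨y', hy⟩)
  · rintro z ⟨_, hz, h'⟩
    have : h.2.choose ⟨z, hz⟩ = ⟨y', hy⟩ := Subtype.ext h'
    rw [← this, Equiv.symm_apply_apply]

end Matched

/-- The relation of a glued model. -/
def glueRel {T : Type} (M N : KripkeModel.{u}) (cM : M.World → T → Prop)
    (cN : N.World → T → Prop) :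
    GlueWorld T M.World N.World → GlueWorld T M.World N.World → Prop
  | .pair (k + 1) x y, .pair k' x' y' => k' = k ∧ Matched M N k x y x' y'
  | .pair 0 x _, .left t x' => M.Rel x x' ∧ cM x' t
  | .pair 0 _ y, .right t y' => N.Rel y y' ∧ cN y' t
  | .left t x, .left t' x' => t' = t ∧ M.Rel x x'
  | .right t y, .right t' y' => t' = t ∧ N.Rel y y'
  | _, _ => False

/-- The hybrid of `M` and `N`: below pairs of worlds at the end of the countdown, the
children from `M` in `P` and the children from `N` in `Q` are kept. -/
abbrev hybrid (M N : KripkeModel.{u}) (P : M.World → Prop) (Q : N.World → Prop) :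
    KripkeModel.{u} where
  World := GlueWorld Unit M.World N.World
  Rel := glueRel M N (fun x _ => P x) (fun y _ => Q y)
  Val
    | p, .pair _ x _ => M.Val p x
    | p, .left _ x => M.Val p x
    | p, .right _ y => N.Val p y

/-- A model in which the letters `0` and `1` mark two hybrids of `M` and `N`. -/
abbrev glue (M N : KripkeModel.{u}) (P : ℕ → M.World → Prop) (Q : ℕ → N.World → Prop) :
    KripkeModel.{u} where
  World := GlueWorld (ℕ → Prop) M.World N.World
  Rel := glueRel M N (fun x t => t = fun i => P i x) (fun y t => t = fun i => Q i y)
  Val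
    | p + 2, .pair _ x _ => M.Val p x
    | p + 2, .left _ x => M.Val p x
    | p + 2, .right _ y => N.Val p y
    | _, .pair _ _ _ => True
    | i, .left t _ => t i
    | i, .right t _ => t i

theorem isGradedBisim_of_existsUnique {Z : M.World → N.World → Prop}
    (hval : ∀ x y, Z x y → ∀ p, M.Val p x ↔ N.Val p y)
    (hforth : ∀ x y, Z x y → ∀ x', M.Rel x x' → ∃! y', N.Rel y y' ∧ Z x' y')
    (hback : ∀ x y, Z x y → ∀ y', N.Rel y y' → ∃! x', M.Rel x x' ∧ Z x' y') :
    M.IsGradedBisim N Z := by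
  intro x y h
  refine ⟨hval x y h, exists_equiv_of_existsUnique
    (fun (x' : {x' // M.Rel x x'}) (y' : {y' // N.Rel y y'}) => Z x'.1 y'.1) ?_ ?_⟩
  · rintro ⟨x', hx'⟩
    obtain ⟨y', ⟨hy', hz⟩, hu⟩ := hforth x y h x' hx'
    exact ⟨⟨y', hy'⟩, hz, fun y'' hz' => Subtype.ext (hu y'' ⟨y''.2, hz'⟩)⟩
  · rintro ⟨y', hy'⟩
    obtain ⟨x', ⟨hx', hz⟩, hu⟩ := hback x y h y' hy'
    exact ⟨⟨x', hx'⟩, hz, fun x'' hz' => Subtype.ext (hu x'' ⟨x''.2, hz'⟩)⟩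

/-- The worlds of a hybrid that agrees with its left component. -/
def LeftRelated (M N : KripkeModel.{u}) : GlueWorld Unit M.World N.World → M.World → Prop
  | .pair k x' y, x => x' = x ∧ GradedEquiv M N k x y
  | .left _ x', x => x' = x
  | .right _ _, _ => False

/-- The worlds of a hybrid that agrees with its right component. -/
def RightRelated (M N : KripkeModel.{u}) : GlueWorld Unit M.World N.World → N.World → Prop
  | .pair k x y', y => y' = y ∧ GradedEquiv M N k x y
  | .left _ _, _ => False
  | .right _ y', y => y' = y

/-- Projection to the first component. The chosen bijections give every `M`-successor exactly one
partner, so a pair has as many successors as its first component; at countdown `0` only children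
from `M` remain. -/
theorem hybrid_left :
    (hybrid M N (fun _ => True) (fun _ => False)).IsGradedBisim M (LeftRelated M N) := by
  refine isGradedBisim_of_existsUnique ?_ ?_ ?_
  · rintro (⟨k, x', y⟩ | ⟨t, x'⟩ | ⟨t, y⟩) x h p
    · rw [h.1]
    · rw [show x' = x from h]
    · exact h.elim
  · rintro (⟨_ | k, x', y⟩ | ⟨t, x'⟩ | ⟨t, y⟩) x h (⟨k', x₁, y₁⟩ | ⟨t', x₁⟩ | ⟨t', y₁⟩) hs <;>
      simp only [glueRel, LeftRelated] at h hs
    · exact ⟨x₁, ⟨h.1 ▸ hs.1, rfl⟩, fun z hz => hz.2.symm⟩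
    · exact hs.2.elim
    · obtain ⟨rfl, hs⟩ := hs
      exact ⟨x₁, ⟨h.1 ▸ hs.rel_left, rfl, hs.gradedEquiv⟩, fun z hz => hz.2.1.symm⟩
    · exact ⟨x₁, ⟨h ▸ hs.2, rfl⟩, fun z hz => hz.2.symm⟩
  · rintro (⟨_ | k, x', y⟩ | ⟨t, x'⟩ | ⟨t, y⟩) x h x₁ hx₁ <;> simp only [LeftRelated] at h
    · refine ⟨.left () x₁, ⟨⟨h.1 ▸ hx₁, trivial⟩, rfl⟩, ?_⟩
      rintro (⟨k', x₂, y₂⟩ | ⟨t', x₂⟩ | ⟨t', y₂⟩) ⟨h₁, h₂⟩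
      · exact h₁.elim
      · rw [show x₂ = x₁ from h₂]
      · exact h₂.elim
    · obtain ⟨rfl, h⟩ := h
      obtain ⟨y₁, hy₁, hu⟩ := existsUnique_matched_right h hx₁
      refine ⟨.pair k x₁ y₁, ⟨⟨rfl, hy₁⟩, rfl, hy₁.gradedEquiv⟩, ?_⟩
      rintro (⟨k', x₂, y₂⟩ | ⟨t', x₂⟩ | ⟨t', y₂⟩) ⟨h₁, h₂⟩
      · obtain ⟨rfl, h₁⟩ := h₁
        obtain ⟨rfl, h₂⟩ := h₂
        rw [hu y₂ h₁]
      · exact h₁.elim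
      · exact h₁.elim
    · subst h
      refine ⟨.left t x₁, ⟨⟨rfl, hx₁⟩, rfl⟩, ?_⟩
      rintro (⟨k', x₂, y₂⟩ | ⟨t', x₂⟩ | ⟨t', y₂⟩) ⟨h₁, h₂⟩
      · exact h₁.elim
      · rw [show x₂ = x₁ from h₂]
      · exact h₂.elim

/-- Mirror image of `hybrid_left`, except that pairs take their letters from `M`, so agreement on
letters comes from `GradedEquiv`. -/
theorem hybrid_right :
    (hybrid M N (fun _ => False) (fun _ => True)).IsGradedBisim N (RightRelated M N) := by
  refine isGradedBisim_of_existsUnique ?_ ?_ ?_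
  · rintro (⟨k, x, y'⟩ | ⟨t, x⟩ | ⟨t, y'⟩) y h p
    · rw [← h.2.val_iff p]
    · exact h.elim
    · rw [show y' = y from h]
  · rintro (⟨_ | k, x, y'⟩ | ⟨t, x⟩ | ⟨t, y'⟩) y h (⟨k', x₁, y₁⟩ | ⟨t', x₁⟩ | ⟨t', y₁⟩) hs <;>
      simp only [glueRel, RightRelated] at h hs
    · exact hs.2.elim
    · exact ⟨y₁, ⟨h.1 ▸ hs.1, rfl⟩, fun z hz => hz.2.symm⟩
    · obtain ⟨rfl, hs⟩ := hs
      exact ⟨y₁, ⟨h.1 ▸ hs.rel_right, rfl, hs.gradedEquiv⟩, fun z hz => hz.2.1.symm⟩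
    · exact ⟨y₁, ⟨h ▸ hs.2, rfl⟩, fun z hz => hz.2.symm⟩
  · rintro (⟨_ | k, x, y'⟩ | ⟨t, x⟩ | ⟨t, y'⟩) y h y₁ hy₁ <;> simp only [RightRelated] at h
    · refine ⟨.right () y₁, ⟨⟨h.1 ▸ hy₁, trivial⟩, rfl⟩, ?_⟩
      rintro (⟨k', x₂, y₂⟩ | ⟨t', x₂⟩ | ⟨t', y₂⟩) ⟨h₁, h₂⟩
      · exact h₁.elim
      · exact h₂.elim
      · rw [show y₂ = y₁ from h₂]
    · obtain ⟨rfl, h⟩ := h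
      obtain ⟨x₁, hx₁, hu⟩ := existsUnique_matched_left h hy₁
      refine ⟨.pair k x₁ y₁, ⟨⟨rfl, hx₁⟩, rfl, hx₁.gradedEquiv⟩, ?_⟩
      rintro (⟨k', x₂, y₂⟩ | ⟨t', x₂⟩ | ⟨t', y₂⟩) ⟨h₁, h₂⟩
      · obtain ⟨rfl, h₁⟩ := h₁
        obtain ⟨rfl, h₂⟩ := h₂
        rw [hu x₂ h₁]
      · exact h₁.elim
      · exact h₁.elim
    · subst h
      refine ⟨.right t y₁, ⟨⟨rfl, hy₁⟩, rfl⟩, ?_⟩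
      rintro (⟨k', x₂, y₂⟩ | ⟨t', x₂⟩ | ⟨t', y₂⟩) ⟨h₁, h₂⟩
      · exact h₁.elim
      · exact h₂.elim
      · rw [show y₂ = y₁ from h₂]

/-- Forget the tag of a world. -/
def GlueWorld.forget {T : Type} {A B : Type u} : GlueWorld T A B → GlueWorld Unit A B
  | .pair k x y => .pair k x y
  | .left _ x => .left () x
  | .right _ y => .right () y

variable {P : ℕ → M.World → Prop} {Q : ℕ → N.World → Prop}

theorem glue_val_pair {i : ℕ} (hi : i < 2) (k : ℕ) (x : M.World) (y : N.World) :
    (glue M N P Q).Val i (.pair k x y) := by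
  interval_cases i <;> trivial

theorem glue_val_left {i : ℕ} (hi : i < 2) (t : ℕ → Prop) (x : M.World) :
    (glue M N P Q).Val i (.left t x) ↔ t i := by
  interval_cases i <;> rfl

theorem glue_val_right {i : ℕ} (hi : i < 2) (t : ℕ → Prop) (y : N.World) :
    (glue M N P Q).Val i (.right t y) ↔ t i := by
  interval_cases i <;> rfl

/-- The tag of a child records which parts contain it and is inherited by all its descendants. Hence
restricting to a part removes only whole subtrees below countdown `0`, and each remaining world has
one tagged copy under a given parent. -/
theorem glue_part {i : ℕ} (hi : i < 2) :
    ((glue M N P Q).part i).IsGradedBisim (hybrid M N (P i) (Q i))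
      fun s t => t = s.1.forget := by
  have hpart (s : (glue M N P Q).World) (hs : (glue M N P Q).Val i s)
      (s' : (glue M N P Q).World) (hs' : (glue M N P Q).Rel s s') :
      (glue M N P Q).Val i s' ↔ (hybrid M N (P i) (Q i)).Rel s.forget s'.forget := by
    rcases s with (⟨_ | k, x, y⟩ | ⟨t, x⟩ | ⟨t, y⟩) <;>
      rcases s' with (⟨k', x₁, y₁⟩ | ⟨t', x₁⟩ | ⟨t', y₁⟩) <;>
      simp only [glueRel] at hs'
    · obtain ⟨h, rfl⟩ := hs'
      exact (glue_val_left hi _ _).trans ⟨fun h' => ⟨h, h'⟩, fun h' => h'.2⟩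
    · obtain ⟨h, rfl⟩ := hs'
      exact (glue_val_right hi _ _).trans ⟨fun h' => ⟨h, h'⟩, fun h' => h'.2⟩
    · exact ⟨fun _ => hs', fun _ => glue_val_pair hi _ _ _⟩
    · obtain ⟨rfl, h⟩ := hs'
      exact (glue_val_left hi _ _).trans
        ⟨fun _ => ⟨rfl, h⟩, fun _ => (glue_val_left hi _ _).1 hs⟩
    · obtain ⟨rfl, h⟩ := hs'
      exact (glue_val_right hi _ _).trans
        ⟨fun _ => ⟨rfl, h⟩, fun _ => (glue_val_right hi _ _).1 hs⟩
  have hlift (s : (glue M N P Q).World) (hs : (glue M N P Q).Val i s)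
      (r : (hybrid M N (P i) (Q i)).World) (hr : (hybrid M N (P i) (Q i)).Rel s.forget r) :
      ∃! s', (glue M N P Q).Rel s s' ∧ r = s'.forget := by
    rcases s with (⟨_ | k, x, y⟩ | ⟨t, x⟩ | ⟨t, y⟩) <;>
      rcases r with (⟨k', x₁, y₁⟩ | ⟨t', x₁⟩ | ⟨t', y₁⟩) <;>
      simp only [glueRel, GlueWorld.forget] at hr
    · refine ⟨.left _ x₁, ⟨⟨hr.1, rfl⟩, rfl⟩, ?_⟩
      rintro (⟨k', x₂, y₂⟩ | ⟨t', x₂⟩ | ⟨t', y₂⟩) ⟨h₁, h₂⟩ <;> cases h₂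
      obtain ⟨h₁, rfl⟩ := h₁
      rfl
    · refine ⟨.right _ y₁, ⟨⟨hr.1, rfl⟩, rfl⟩, ?_⟩
      rintro (⟨k', x₂, y₂⟩ | ⟨t', x₂⟩ | ⟨t', y₂⟩) ⟨h₁, h₂⟩ <;> cases h₂
      obtain ⟨h₁, rfl⟩ := h₁
      rfl
    · refine ⟨.pair k' x₁ y₁, ⟨hr, rfl⟩, ?_⟩
      rintro (⟨k', x₂, y₂⟩ | ⟨t', x₂⟩ | ⟨t', y₂⟩) ⟨h₁, h₂⟩ <;> cases h₂
      rfl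
    · refine ⟨.left t x₁, ⟨⟨rfl, hr.2⟩, rfl⟩, ?_⟩
      rintro (⟨k', x₂, y₂⟩ | ⟨t', x₂⟩ | ⟨t', y₂⟩) ⟨h₁, h₂⟩ <;> cases h₂
      rw [h₁.1]
    · refine ⟨.right t y₁, ⟨⟨rfl, hr.2⟩, rfl⟩, ?_⟩
      rintro (⟨k', x₂, y₂⟩ | ⟨t', x₂⟩ | ⟨t', y₂⟩) ⟨h₁, h₂⟩ <;> cases h₂
      rw [h₁.1]
  refine isGradedBisim_of_existsUnique ?_ ?_ ?_
  · rintro ⟨s, hs⟩ _ rfl p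
    cases s <;> rfl
  · rintro ⟨s, hs⟩ _ rfl ⟨s', hs'⟩ h
    exact ⟨s'.forget, ⟨(hpart s hs s' h).1 hs', rfl⟩, fun r hr => hr.2⟩
  · rintro ⟨s, hs⟩ _ rfl r hr
    obtain ⟨s', ⟨h, rfl⟩, hu⟩ := hlift s hs r hr
    refine ⟨⟨s', (hpart s hs s' h).2 hr⟩, ⟨h, rfl⟩, ?_⟩
    rintro ⟨s'', hs''⟩ ⟨h₁, h₂⟩
    exact Subtype.ext (hu s'' ⟨h₁, h₂⟩)

/-- Tags are constant below a copy, so a part that contains the copy contains everything generated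
from it. -/
theorem glue_part_left {i : ℕ} (hi : i < 2) :
    ((glue M N P Q).part i).IsGradedBisim M fun s x => ∃ t, s.1 = .left t x := by
  refine isGradedBisim_of_existsUnique ?_ ?_ ?_
  · rintro ⟨s, hs⟩ x ⟨t, rfl⟩ p
    rfl
  · rintro ⟨s, hs⟩ x ⟨t, rfl⟩ ⟨s', hs'⟩ h
    rcases s' with (⟨k', x₁, y₁⟩ | ⟨t', x₁⟩ | ⟨t', y₁⟩)
    · exact h.elim
    · refine ⟨x₁, ⟨h.2, t', rfl⟩, ?_⟩
      rintro z ⟨-, t'', hz⟩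
      cases hz
      rfl
    · exact h.elim
  · rintro ⟨s, hs⟩ x ⟨t, rfl⟩ x₁ hx₁
    refine ⟨⟨.left t x₁, (glue_val_left hi t x₁).2 ((glue_val_left hi t x).1 hs)⟩,
      ⟨⟨rfl, hx₁⟩, t, rfl⟩, ?_⟩
    rintro ⟨s', hs'⟩ ⟨h, t', rfl⟩
    obtain rfl : t' = t := h.1
    rfl

theorem glue_part_right {i : ℕ} (hi : i < 2) :
    ((glue M N P Q).part i).IsGradedBisim N fun s y => ∃ t, s.1 = .right t y := by
  refine isGradedBisim_of_existsUnique ?_ ?_ ?_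
  · rintro ⟨s, hs⟩ y ⟨t, rfl⟩ p
    rfl
  · rintro ⟨s, hs⟩ y ⟨t, rfl⟩ ⟨s', hs'⟩ h
    rcases s' with (⟨k', x₁, y₁⟩ | ⟨t', x₁⟩ | ⟨t', y₁⟩)
    · exact h.elim
    · exact h.elim
    · refine ⟨y₁, ⟨h.2, t', rfl⟩, ?_⟩
      rintro z ⟨-, t'', hz⟩
      cases hz
      rfl
  · rintro ⟨s, hs⟩ y ⟨t, rfl⟩ y₁ hy₁
    refine ⟨⟨.right t y₁, (glue_val_right hi t y₁).2 ((glue_val_right hi t y).1 hs)⟩,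
      ⟨⟨rfl, hy₁⟩, t, rfl⟩, ?_⟩
    rintro ⟨s', hs'⟩ ⟨h, t', rfl⟩
    obtain rfl : t' = t := h.1
    rfl

theorem glue_reach_pair {d n : ℕ} {x : M.World} {y : N.World} (h : GradedEquiv M N d x y)
    {s : (glue M N P Q).World} (hn : n ≤ d) (hs : (glue M N P Q).Reach n (.pair d x y) s) :
    ∃ x' y', s = .pair (d - n) x' y' ∧ GradedEquiv M N (d - n) x' y' := by
  induction n generalizing d x y with
  | zero => exact ⟨x, y, hs.symm, h⟩
  | succ n ih =>
    obtain ⟨d, rfl⟩ : ∃ d', d = d' + 1 := ⟨d - 1, by omega⟩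
    obtain ⟨r, hr, hs⟩ := hs
    rcases r with (⟨k', x₁, y₁⟩ | ⟨t', x₁⟩ | ⟨t', y₁⟩)
    · obtain ⟨rfl, hr⟩ := hr
      rw [Nat.add_sub_add_right]
      exact ih hr.gradedEquiv (by omega) hs
    · exact hr.elim
    · exact hr.elim

/-- The countdown runs out after exactly `d` steps, so one more step enters the tagged copies, and
the tag is the one computed at that child. -/
theorem glue_reach_child {d : ℕ} {x : M.World} {y : N.World} (h : GradedEquiv M N d x y)
    {s : (glue M N P Q).World} (hs : (glue M N P Q).Reach (d + 1) (.pair d x y) s) :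
    (∃ x', s = .left (fun i => P i x') x') ∨ ∃ y', s = .right (fun i => Q i y') y' := by
  induction d generalizing x y with
  | zero =>
    obtain ⟨r, hr, rfl⟩ := hs
    rcases r with (⟨k', x₁, y₁⟩ | ⟨t', x₁⟩ | ⟨t', y₁⟩)
    · exact hr.elim
    · exact Or.inl ⟨x₁, by rw [hr.2]⟩
    · exact Or.inr ⟨y₁, by rw [hr.2]⟩
  | succ n ih =>
    obtain ⟨r, hr, hs⟩ := hs
    rcases r with (⟨k', x₁, y₁⟩ | ⟨t', x₁⟩ | ⟨t', y₁⟩)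
    · obtain ⟨rfl, hr⟩ := hr
      exact ih hr.gradedEquiv hs
    · exact hr.elim
    · exact hr.elim

end KripkeModel

/-! ### Comparing the two parts of a countable model. -/

/-- Graded modalities see only finite cardinalities; among countable sets these determine the size.
This is where the Löwenheim–Skolem property is needed. -/
theorem exists_equiv_of_finset_card {X Y : Type*} [Countable X] [Countable Y]
    (h : ∀ k, (∃ s : Finset X, s.card = k) ↔ ∃ s : Finset Y, s.card = k) : Nonempty (X ≃ Y) := by
  rcases finite_or_infinite X with hX | hX <;> rcases finite_or_infinite Y with hY | hY
  · have := Fintype.ofFinite X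
    have := Fintype.ofFinite Y
    obtain ⟨s, hs⟩ := (h (Fintype.card X)).1 ⟨Finset.univ, rfl⟩
    obtain ⟨t, ht⟩ := (h (Fintype.card Y)).2 ⟨Finset.univ, rfl⟩
    exact ⟨Fintype.equivOfCardEq (le_antisymm (hs ▸ s.card_le_univ) (ht ▸ t.card_le_univ))⟩
  · have := Fintype.ofFinite X
    obtain ⟨s, hs⟩ := (h (Fintype.card X + 1)).2 (Infinite.exists_subset_card_eq Y _)
    have := s.card_le_univ
    omega
  · have := Fintype.ofFinite Y
    obtain ⟨s, hs⟩ := (h (Fintype.card Y + 1)).1 (Infinite.exists_subset_card_eq X _)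
    have := s.card_le_univ
    omega
  · exact nonempty_equiv_of_countable

namespace KripkeModel

/-- If two parts of a countable model agree up to depth `d`, and below depth `d` the worlds
that belong to only one of them are equally many and satisfy the same graded modal
formulas, then the two parts are related by `GradedEquiv`. -/
theorem gradedEquiv_parts {A : KripkeModel.{u}} (hA : Countable A.World) {a : A.World} {d : ℕ}
    (hab : ∀ i ≤ d, ∀ x, A.Reach i a x → A.Val 0 x ∧ A.Val 1 x)
    (hcount : ∀ x, A.Reach d a x → ∀ k,
      (∃ s : Finset {y // A.Rel x y ∧ A.Val 0 y ∧ ¬ A.Val 1 y}, s.card = k) ↔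
        ∃ s : Finset {y // A.Rel x y ∧ ¬ A.Val 0 y ∧ A.Val 1 y}, s.card = k)
    (hboth : ∀ x, A.Reach (d + 1) a x → ∀ (h₀ : A.Val 0 x) (h₁ : A.Val 1 x) (ψ : GMLFormula),
      ψ.Sat (A.part 0) ⟨x, h₀⟩ ↔ ψ.Sat (A.part 1) ⟨x, h₁⟩)
    (hone : ∀ x y, A.Reach (d + 1) a x → A.Reach (d + 1) a y →
      ∀ (h₀ : A.Val 0 x) (h₁ : A.Val 1 y), ¬ A.Val 1 x → ¬ A.Val 0 y → ∀ ψ : GMLFormula,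
      ψ.Sat (A.part 0) ⟨x, h₀⟩ ↔ ψ.Sat (A.part 1) ⟨y, h₁⟩)
    (h₀ : A.Val 0 a) (h₁ : A.Val 1 a) :
    GradedEquiv (A.part 0) (A.part 1) (d + 1) ⟨a, h₀⟩ ⟨a, h₁⟩ := by
  suffices H : ∀ k i x, k + i = d → A.Reach i a x → ∀ (h₀ : A.Val 0 x) (h₁ : A.Val 1 x),
      GradedEquiv (A.part 0) (A.part 1) (k + 1) ⟨x, h₀⟩ ⟨x, h₁⟩ from
    H d 0 a rfl rfl h₀ h₁
  intro k
  induction k with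
  | zero =>
    intro i x hi hx h₀ h₁
    obtain rfl : i = d := by omega
    refine ⟨fun p => Iff.rfl, ?_⟩
    obtain ⟨e⟩ := exists_equiv_of_finset_card (hcount x hx)
    -- Children common to both parts are matched with themselves, and those in only one part through
    -- `e`.
    have hf := exists_equiv_of_existsUnique
      (fun (y : {y // (A.part 0).Rel ⟨x, h₀⟩ y}) (z : {z // (A.part 1).Rel ⟨x, h₁⟩ z}) =>
        y.1.1 = z.1.1 ∨ ∃ hy hz, e ⟨y.1.1, hy⟩ = ⟨z.1.1, hz⟩)
    obtain ⟨f, hf⟩ := by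
      refine hf ?_ ?_
      · rintro ⟨⟨y, hy₀⟩, hy⟩
        by_cases hy₁ : A.Val 1 y
        · refine ⟨⟨⟨y, hy₁⟩, hy⟩, Or.inl rfl, ?_⟩
          rintro ⟨⟨z, hz₁⟩, hz⟩ (h | ⟨h, -⟩)
          · exact Subtype.ext (Subtype.ext h.symm)
          · exact (h.2.2 hy₁).elim
        · let z := e ⟨y, hy, hy₀, hy₁⟩
          refine ⟨⟨⟨z.1, z.2.2.2⟩, z.2.1⟩, Or.inr ⟨⟨hy, hy₀, hy₁⟩, z.2, rfl⟩, ?_⟩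
          rintro ⟨⟨z', hz₁⟩, hz⟩ (h | ⟨_, _, h⟩)
          · exact (hy₁ ((show y = z' from h) ▸ hz₁)).elim
          · have := congrArg Subtype.val h.symm
            exact Subtype.ext (Subtype.ext this)
      · rintro ⟨⟨z, hz₁⟩, hz⟩
        by_cases hz₀ : A.Val 0 z
        · refine ⟨⟨⟨z, hz₀⟩, hz⟩, Or.inl rfl, ?_⟩
          rintro ⟨⟨y, hy₁⟩, hy⟩ (h | ⟨-, h, -⟩)
          · exact Subtype.ext (Subtype.ext h)
          · exact (h.2.1 hz₀).elim
        · let y := e.symm ⟨z, hz, hz₀, hz₁⟩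
          refine ⟨⟨⟨y.1, y.2.2.1⟩, y.2.1⟩, Or.inr ⟨y.2, ⟨hz, hz₀, hz₁⟩, ?_⟩, ?_⟩
          · exact e.apply_symm_apply _
          · rintro ⟨⟨y', hy₀⟩, hy⟩ (h | ⟨_, _, h⟩)
            · exact (hz₀ ((show y' = z from h) ▸ hy₀)).elim
            · refine Subtype.ext (Subtype.ext ?_)
              have := congrArg e.symm h
              rw [e.symm_apply_apply] at this
              have := congrArg Subtype.val this
              exact this
    refine ⟨f, fun y => ?_⟩
    rcases hf y with h | ⟨hy, hz, -⟩
    · have hy₁ : A.Val 1 y.1.1 := h ▸ (f y).1.2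
      have heq : (f y).1 = ⟨y.1.1, hy₁⟩ := Subtype.ext h.symm
      rw [heq]
      exact hboth _ (hx.succ y.2) _ _
    · exact hone _ _ (hx.succ y.2) (hx.succ (f y).2) _ _ hy.2.2 hz.2.1
  | succ k ih =>
    intro i x hi hx h₀ h₁
    refine ⟨fun p => Iff.rfl, ?_⟩
    have hsucc (y : A.World) (hy : A.Rel x y) := hab (i + 1) (by omega) y (hx.succ hy)
    -- Above level `d` all successors lie in both parts, so the identity serves as the bijection.
    refine ⟨⟨fun y => ⟨⟨y.1.1, (hsucc _ y.2).2⟩, y.2⟩, fun y => ⟨⟨y.1.1, (hsucc _ y.2).1⟩, y.2⟩,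
      fun _ => rfl, fun _ => rfl⟩, fun y => ?_⟩
    exact ih (i + 1) y.1.1 (by omega) (hx.succ y.2) _ _

/-- The pairing of a world with itself, in two parts that agree on all reachable worlds. -/
theorem isGradedBisim_parts {A : KripkeModel.{u}} {a : A.World}
    (hab : ∀ i x, A.Reach i a x → A.Val 0 x ∧ A.Val 1 x) :
    (A.part 0).IsGradedBisim (A.part 1) fun x y => x.1 = y.1 ∧ ∃ i, A.Reach i a x.1 := by
  rintro ⟨x, hx₀⟩ ⟨y, hx₁⟩ ⟨h, i, hx⟩
  obtain rfl : x = y := h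
  refine ⟨fun p => Iff.rfl, ?_⟩
  have hsucc (y : A.World) (hy : A.Rel x y) := hab (i + 1) y (hx.succ hy)
  exact ⟨⟨fun y => ⟨⟨y.1.1, (hsucc _ y.2).2⟩, y.2⟩, fun y => ⟨⟨y.1.1, (hsucc _ y.2).1⟩, y.2⟩,
    fun _ => rfl, fun _ => rfl⟩, fun y => ⟨rfl, i + 1, hx.succ y.2⟩⟩

end KripkeModel

/-! ### Every formula has bounded depth. -/

namespace AbstractModalLogic

open KripkeModel GMLFormula

variable {L : AbstractModalLogic.{u, v}}

/-- Compactness and the Löwenheim–Skolem property, for one formula and a family of sets of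
graded modal formulas. -/
theorem exists_countable_of_finset (hL : L.Extends GML.{u}) (hC : L.Compactness)
    (hS : L.LowenheimSkolem) {ι : Type*} (θ : L.Fml) (g : ι → Set GMLFormula)
    (h : ∀ s : Finset ι, ∃ (M : KripkeModel.{u}) (a : M.World),
      L.Sat θ M a ∧ ∀ i ∈ s, ∀ γ ∈ g i, γ.Sat M a) :
    ∃ (M : KripkeModel.{u}) (a : M.World), Countable M.World ∧ L.Sat θ M a ∧
      ∀ i, ∀ γ ∈ g i, γ.Sat M a := by
  classical
  obtain ⟨f, hf⟩ := hL
  have hf' (γ : GMLFormula) (M : KripkeModel.{u}) (a : M.World) : L.Sat (f γ) M a ↔ γ.Sat M a :=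
    (hf γ M a).symm
  obtain ⟨M, a, hM, hsat⟩ := hS ({θ} ∪ f '' ⋃ i, g i) <| hC _ <| by
    intro F hF hfin
    -- A set `g i` may be infinite, so finiteness is moved to the indices: each member of `F` needs
    -- at most one.
    have hchoice : ∀ φ : L.Fml, ∃ s : Finset ι, φ ∈ F →
        φ = θ ∨ ∃ i ∈ s, ∃ γ ∈ g i, f γ = φ := by
      intro φ
      by_cases hφ : φ ∈ F
      · rcases hF hφ with h | ⟨γ, hγ, rfl⟩
        · exact ⟨∅, fun _ => Or.inl h⟩
        · obtain ⟨i, hi⟩ := Set.mem_iUnion.1 hγ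
          exact ⟨{i}, fun _ => Or.inr ⟨i, Finset.mem_singleton_self i, γ, hi, rfl⟩⟩
      · exact ⟨∅, fun h => (hφ h).elim⟩
    choose s hs using hchoice
    obtain ⟨M, a, hθ, hg⟩ := h (hfin.toFinset.biUnion s)
    refine ⟨M, a, fun φ hφ => ?_⟩
    rcases hs φ hφ with rfl | ⟨i, hi, γ, hγ, rfl⟩
    · exact hθ
    · exact (hf' γ M a).2
        (hg i (Finset.mem_biUnion.2 ⟨_, hfin.mem_toFinset.2 hφ, hi⟩) γ hγ)
  refine ⟨M, a, hM, hsat θ (Or.inl rfl), fun i γ hγ => (hf' γ M a).1 ?_⟩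
  exact hsat _ (Or.inr ⟨γ, Set.mem_iUnion.2 ⟨i, hγ⟩, rfl⟩)

/-- Some formula says that the two parts of a model disagree about `φ`. -/
theorem exists_distinguish (φ : L.Fml) : ∃ θ : L.Fml, ∀ (M : KripkeModel.{u}) (a : M.World)
    (h₀ : M.Val 0 a) (h₁ : M.Val 1 a),
    L.Sat θ M a ↔ L.Sat φ (M.part 0) ⟨a, h₀⟩ ∧ ¬ L.Sat φ (M.part 1) ⟨a, h₁⟩ := by
  obtain ⟨φ', hφ'⟩ := L.closed_rename (· + 2) φ
  obtain ⟨φ₀, hφ₀⟩ := L.closed_relativize 0 φ'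
  obtain ⟨φ₁, hφ₁⟩ := L.closed_relativize 1 φ'
  obtain ⟨φ₂, hφ₂⟩ := L.closed_neg φ₁
  obtain ⟨θ, hθ⟩ := L.closed_and φ₀ φ₂
  refine ⟨θ, fun M a h₀ h₁ => ?_⟩
  rw [hθ, hφ₀ M a h₀, hφ₂, hφ₁ M a h₁, hφ', hφ']

theorem UnravelingInvariant.sat_hybrid_left (hU : L.UnravelingInvariant) (φ : L.Fml)
    {M N : KripkeModel.{u}} {P : M.World → Prop} {Q : N.World → Prop} {d : ℕ}
    {a : M.World} {b : N.World} (h : GradedEquiv M N d a b)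
    (hP : ∀ x, P x) (hQ : ∀ y, ¬ Q y) :
    L.Sat φ (hybrid M N P Q) (.pair d a b) ↔ L.Sat φ M a := by
  obtain rfl : P = fun _ => True := funext fun x => eq_true (hP x)
  obtain rfl : Q = fun _ => False := funext fun y => eq_false (hQ y)
  exact hU.sat_bisim hybrid_left φ ⟨rfl, h⟩

theorem UnravelingInvariant.sat_hybrid_right (hU : L.UnravelingInvariant) (φ : L.Fml)
    {M N : KripkeModel.{u}} {P : M.World → Prop} {Q : N.World → Prop} {d : ℕ}
    {a : M.World} {b : N.World} (h : GradedEquiv M N d a b)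
    (hP : ∀ x, ¬ P x) (hQ : ∀ y, Q y) :
    L.Sat φ (hybrid M N P Q) (.pair d a b) ↔ L.Sat φ N b := by
  obtain rfl : P = fun _ => False := funext fun x => eq_false (hP x)
  obtain rfl : Q = fun _ => True := funext fun y => eq_true (hQ y)
  exact hU.sat_bisim hybrid_right φ ⟨rfl, h⟩

theorem UnravelingInvariant.sat_glue_part (hU : L.UnravelingInvariant) (φ : L.Fml)
    {M N : KripkeModel.{u}} {P : ℕ → M.World → Prop} {Q : ℕ → N.World → Prop} {i : ℕ}
    (hi : i < 2) {s : (glue M N P Q).World} (hs : (glue M N P Q).Val i s) :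
    L.Sat φ ((glue M N P Q).part i) ⟨s, hs⟩ ↔ L.Sat φ (hybrid M N (P i) (Q i)) s.forget :=
  hU.sat_bisim (glue_part hi) φ rfl

/-- Each formula of a compact unraveling-invariant logic is preserved by `GradedEquiv` of
some depth. -/
theorem exists_depth (hL : L.Extends GML.{u}) (hU : L.UnravelingInvariant)
    (hC : L.Compactness) (hS : L.LowenheimSkolem) (φ : L.Fml) :
    ∃ n, ∀ (M N : KripkeModel.{u}) (a : M.World) (b : N.World), GradedEquiv M N n a b →
      L.Sat φ M a → L.Sat φ N b := by
  by_contra! hcon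
  obtain ⟨θ, hθ⟩ := exists_distinguish φ
  obtain ⟨A, a, -, hA, hpq⟩ := exists_countable_of_finset hL hC hS θ
    (fun n : ℕ => {box n (and (letter 0) (letter 1))}) <| by
    intro s
    -- The largest depth requested in `s`; every requested box then stays among the pairs.
    obtain ⟨M, N, a, b, hab, ha, hb⟩ := hcon (s.sup id)
    refine ⟨glue M N (fun i _ => i = 0) (fun i _ => i = 1), .pair (s.sup id) a b, ?_, ?_⟩
    · rw [hθ _ _ (glue_val_pair (by norm_num) _ _ _) (glue_val_pair (by norm_num) _ _ _),
        hU.sat_glue_part φ (by norm_num), hU.sat_glue_part φ (by norm_num)]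
      constructor
      · exact (hU.sat_hybrid_left φ hab (by simp) (by simp)).2 ha
      · exact fun h => hb ((hU.sat_hybrid_right φ hab (by simp) (by simp)).1 h)
    · rintro i hi _ rfl
      rw [sat_box]
      intro x hx
      obtain ⟨x', y', rfl, -⟩ := glue_reach_pair hab (Finset.le_sup (f := id) hi) hx
      exact ⟨glue_val_pair (by norm_num) _ _ _, glue_val_pair (by norm_num) _ _ _⟩
  have hab : ∀ i x, A.Reach i a x → A.Val 0 x ∧ A.Val 1 x := by
    intro i x hx
    have := hpq i _ rfl
    rw [sat_box] at this
    exact this x hx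
  obtain ⟨h₀, h₁⟩ := hab 0 a rfl
  obtain ⟨h, h'⟩ := (hθ A a h₀ h₁).1 hA
  exact h' ((hU.sat_bisim (isGradedBisim_parts hab) φ
    (a := ⟨a, h₀⟩) (b := ⟨a, h₁⟩) ⟨rfl, 0, rfl⟩).1 h)

end AbstractModalLogic

/-! ### Exchanging one class of children. -/

theorem Finset.exists_insert_of_not {α : Type*} [DecidableEq α] {p : Finset α → Prop}
    (h₀ : p ∅) {t : Finset α} (ht : ¬ p t) : ∃ s a, a ∉ s ∧ p s ∧ ¬ p (insert a s) := by
  by_contra! h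
  exact ht (Finset.induction_on t h₀ fun a s has hs => h s a has hs)

namespace GMLFormula

open KripkeModel

open Classical in
/-- The formulas of `s` that hold at a world. -/
noncomputable def profile (s : Finset GMLFormula) (M : KripkeModel.{u}) (a : M.World) :
    Finset GMLFormula :=
  s.filter fun ψ => Sat ψ M a

theorem mem_profile {s : Finset GMLFormula} {M : KripkeModel.{u}} {a : M.World}
    {ψ : GMLFormula} : ψ ∈ profile s M a ↔ ψ ∈ s ∧ Sat ψ M a := by
  simp [profile]

theorem exists_profile_formula (s e : Finset GMLFormula) :
    ∃ χ : GMLFormula, ∀ (M : KripkeModel.{u}) (a : M.World), Sat χ M a ↔ profile s M a = e := by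
  by_cases he : e ⊆ s
  · obtain ⟨χ, hχ⟩ := exists_class_formula s e
    refine ⟨χ, fun M a => (hχ M a).trans ⟨fun h => ?_, fun h ψ hψ => ?_⟩⟩
    · ext ψ
      rw [mem_profile]
      exact ⟨fun hψ => (h ψ hψ.1).1 hψ.2, fun hψ => ⟨he hψ, (h ψ (he hψ)).2 hψ⟩⟩
    · rw [← h, mem_profile]
      simp [hψ]
  -- Profiles are subsets of `s`, so this `e` never occurs and a contradiction defines it.
  · refine ⟨and (letter 0) (neg (letter 0)), fun M a => ⟨fun h => (h.2 h.1).elim, ?_⟩⟩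
    rintro rfl
    exact (he fun ψ hψ => (mem_profile.1 hψ).1).elim

/-- The formulas that hold, with respect to `ψ`, in a model whose parts are two hybrids that
differ in one class of children. -/
def partAxioms (d : ℕ) (ψ : GMLFormula) : Set GMLFormula :=
  {γ | (∃ i ≤ d, γ = box i (and (letter 0) (letter 1))) ∨
    (∃ k, γ = box d (iff (dia k (and (letter 0) (neg (letter 1))))
      (dia k (and (neg (letter 0)) (letter 1))))) ∨
    γ = box (d + 1) (imp (and (letter 0) (letter 1)) (iff (onPart 0 ψ) (onPart 1 ψ))) ∨
    γ = or
      (box (d + 1) (and (imp (and (letter 0) (neg (letter 1))) (onPart 0 ψ))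
        (imp (and (neg (letter 0)) (letter 1)) (onPart 1 ψ))))
      (box (d + 1) (and (imp (and (letter 0) (neg (letter 1))) (neg (onPart 0 ψ)))
        (imp (and (neg (letter 0)) (letter 1)) (neg (onPart 1 ψ)))))}

/-- With `ψ` ranging over all formulas, the last axiom makes all children in only one part share one
complete graded theory, each evaluated in its own part. -/
theorem gradedEquiv_of_partAxioms {A : KripkeModel.{u}} (hA : Countable A.World) {a : A.World}
    {d : ℕ} (h : ∀ ψ, ∀ γ ∈ partAxioms d ψ, Sat γ A a) (h₀ : A.Val 0 a) (h₁ : A.Val 1 a) :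
    GradedEquiv (A.part 0) (A.part 1) (d + 1) ⟨a, h₀⟩ ⟨a, h₁⟩ := by
  refine gradedEquiv_parts hA ?_ ?_ ?_ ?_ h₀ h₁
  · intro i hi x hx
    -- This axiom does not depend on `ψ`, so any formula will do as index.
    have := h (letter 0) _ (Or.inl ⟨i, hi, rfl⟩)
    rw [sat_box] at this
    exact this x hx
  · intro x hx k
    have := h (letter 0) _ (Or.inr (Or.inl ⟨k, rfl⟩))
    rw [sat_box] at this
    have := this x hx
    rwa [sat_iff, sat_dia_iff_subtype, sat_dia_iff_subtype] at this
  · intro x hx h₀ h₁ ψ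
    have := h ψ _ (Or.inr (Or.inr (Or.inl rfl)))
    rw [sat_box] at this
    have := this x hx
    rw [sat_imp, sat_iff, sat_onPart h₀, sat_onPart h₁] at this
    exact this ⟨h₀, h₁⟩
  · intro x y hx hy h₀ h₁ hx₁ hy₀ ψ
    have := h ψ _ (Or.inr (Or.inr (Or.inr rfl)))
    rw [sat_or, sat_box, sat_box] at this
    rcases this with this | this
    · have hx' := (this x hx).1
      have hy' := (this y hy).2
      rw [sat_imp, sat_onPart h₀] at hx'
      rw [sat_imp, sat_onPart h₁] at hy'
      exact iff_of_true (hx' ⟨h₀, hx₁⟩) (hy' ⟨hy₀, h₁⟩)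
    · have hx' := (this x hx).1
      have hy' := (this y hy).2
      rw [sat_imp, sat_neg, sat_onPart h₀] at hx'
      rw [sat_imp, sat_neg, sat_onPart h₁] at hy'
      exact iff_of_false (hx' ⟨h₀, hx₁⟩) (hy' ⟨hy₀, h₁⟩)

section Swap

variable {M N : KripkeModel.{u}} {s e : Finset GMLFormula} {c : Finset (Finset GMLFormula)}

open Classical in
/-- The model whose parts are the hybrids for the sets of classes `c` and `insert e c`. -/
noncomputable abbrev swapModel (M N : KripkeModel.{u}) (s e : Finset GMLFormula)
    (c : Finset (Finset GMLFormula)) : KripkeModel.{u} :=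
  glue M N (fun i x => profile s M x ∉ if i = 0 then c else insert e c)
    (fun i y => profile s N y ∈ if i = 0 then c else insert e c)

/-- Because `e ∉ c`, the children in part `0` only are those from `M` with profile `e`, and the
children in part `1` only are those from `N` with profile `e`; all others lie in both parts or in
neither. -/
theorem swapModel_partAxioms (he : e ∉ c) {d : ℕ} {a : M.World} {b : N.World}
    (hab : GradedEquiv M N d a b) {ψ γ : GMLFormula} (hψ : ψ ∈ s) (hγ : γ ∈ partAxioms d ψ) :
    Sat γ (swapModel M N s e c) (.pair d a b) := by
  classical
  have leftOnly (t : ℕ → Prop) (x : M.World)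
      (ht : t = fun i => profile s M x ∉ if i = 0 then c else insert e c) :
      ((swapModel M N s e c).Val 0 (.left t x) ∧ ¬ (swapModel M N s e c).Val 1 (.left t x) ↔
        profile s M x = e) ∧
      ¬ (¬ (swapModel M N s e c).Val 0 (.left t x) ∧
        (swapModel M N s e c).Val 1 (.left t x)) := by
    rw [glue_val_left (by norm_num), glue_val_left (by norm_num), ht]
    simp only [if_true, one_ne_zero, if_false, Finset.mem_insert, not_or, not_and, not_not]
    grind
  have rightOnly (t : ℕ → Prop) (y : N.World)
      (ht : t = fun i => profile s N y ∈ if i = 0 then c else insert e c) :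
      (¬ (swapModel M N s e c).Val 0 (.right t y) ∧ (swapModel M N s e c).Val 1 (.right t y) ↔
        profile s N y = e) ∧
      ¬ ((swapModel M N s e c).Val 0 (.right t y) ∧
        ¬ (swapModel M N s e c).Val 1 (.right t y)) := by
    rw [glue_val_right (by norm_num), glue_val_right (by norm_num), ht]
    simp only [if_true, one_ne_zero, if_false, Finset.mem_insert]
    grind
  have satLeft (i : ℕ) (hi : i < 2) (t : ℕ → Prop) (x : M.World)
      (h : (swapModel M N s e c).Val i (.left t x)) :
      Sat (onPart i ψ) (swapModel M N s e c) (.left t x) ↔ Sat ψ M x := by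
    rw [sat_onPart h]
    exact sat_bisim (glue_part_left hi) ψ ⟨t, rfl⟩
  have satRight (i : ℕ) (hi : i < 2) (t : ℕ → Prop) (y : N.World)
      (h : (swapModel M N s e c).Val i (.right t y)) :
      Sat (onPart i ψ) (swapModel M N s e c) (.right t y) ↔ Sat ψ N y := by
    rw [sat_onPart h]
    exact sat_bisim (glue_part_right hi) ψ ⟨t, rfl⟩
  rcases hγ with ⟨i, hi, rfl⟩ | ⟨k, rfl⟩ | rfl | rfl
  · rw [sat_box]
    intro x hx
    obtain ⟨x', y', rfl, -⟩ := glue_reach_pair hab hi hx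
    exact ⟨glue_val_pair (by norm_num) _ _ _, glue_val_pair (by norm_num) _ _ _⟩
  · rw [sat_box]
    intro r hr
    obtain ⟨x, y, rfl, hxy⟩ := glue_reach_pair hab le_rfl hr
    rw [Nat.sub_self] at hxy ⊢
    -- Both counts become instances of `dia k χ`, at `x` and at `y`; these worlds are
    -- `GML`-equivalent because the countdown has reached `0`.
    obtain ⟨χ, hχ⟩ := exists_profile_formula.{u} s e
    have hM : Sat (dia k (and (letter 0) (neg (letter 1)))) (swapModel M N s e c)
        (.pair 0 x y) ↔ Sat (dia k χ) M x := by
      obtain ⟨f, -⟩ := exists_equiv_of_existsUnique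
        (fun (r : {r // (swapModel M N s e c).Rel (.pair 0 x y) r ∧
            Sat (and (letter 0) (neg (letter 1))) (swapModel M N s e c) r})
          (x' : {x' // M.Rel x x' ∧ Sat χ M x'}) => ∃ t, r.1 = .left t x'.1)
        (by
          rintro ⟨⟨k', x₁, y₁⟩ | ⟨t', x₁⟩ | ⟨t', y₁⟩, hr, hr'⟩
          · exact hr.elim
          · refine ⟨⟨x₁, hr.1, (hχ _ _).2 ((leftOnly t' x₁ hr.2).1.1 hr')⟩, ⟨t', rfl⟩, ?_⟩
            rintro ⟨x', hx'⟩ ⟨t, ht⟩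
            cases ht
            rfl
          · exact ((rightOnly t' y₁ hr.2).2 hr').elim)
        (by
          rintro ⟨x', hx', hx''⟩
          refine ⟨⟨.left _ x', ⟨hx', rfl⟩, (leftOnly _ x' rfl).1.2 ((hχ _ _).1 hx'')⟩,
            ⟨_, rfl⟩, ?_⟩
          rintro ⟨r, hr, hr'⟩ ⟨t, rfl⟩
          obtain rfl := hr.2
          rfl)
      exact sat_dia_congr f
    have hN : Sat (dia k (and (neg (letter 0)) (letter 1))) (swapModel M N s e c)
        (.pair 0 x y) ↔ Sat (dia k χ) N y := by
      obtain ⟨f, -⟩ := exists_equiv_of_existsUnique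
        (fun (r : {r // (swapModel M N s e c).Rel (.pair 0 x y) r ∧
            Sat (and (neg (letter 0)) (letter 1)) (swapModel M N s e c) r})
          (y' : {y' // N.Rel y y' ∧ Sat χ N y'}) => ∃ t, r.1 = .right t y'.1)
        (by
          rintro ⟨⟨k', x₁, y₁⟩ | ⟨t', x₁⟩ | ⟨t', y₁⟩, hr, hr'⟩
          · exact hr.elim
          · exact ((leftOnly t' x₁ hr.2).2 hr').elim
          · refine ⟨⟨y₁, hr.1, (hχ _ _).2 ((rightOnly t' y₁ hr.2).1.1 hr')⟩, ⟨t', rfl⟩, ?_⟩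
            rintro ⟨y', hy'⟩ ⟨t, ht⟩
            cases ht
            rfl)
        (by
          rintro ⟨y', hy', hy''⟩
          refine ⟨⟨.right _ y', ⟨hy', rfl⟩, (rightOnly _ y' rfl).1.2 ((hχ _ _).1 hy'')⟩,
            ⟨_, rfl⟩, ?_⟩
          rintro ⟨r, hr, hr'⟩ ⟨t, rfl⟩
          obtain rfl := hr.2
          rfl)
      exact sat_dia_congr f
    rw [sat_iff, hM, hN]
    exact hxy _
  · rw [sat_box]
    intro r hr
    rw [sat_imp, sat_iff]
    rintro ⟨h₀, h₁⟩
    rcases glue_reach_child hab hr with ⟨x', rfl⟩ | ⟨y', rfl⟩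
    · rw [satLeft 0 (by norm_num) _ _ h₀, satLeft 1 (by norm_num) _ _ h₁]
    · rw [satRight 0 (by norm_num) _ _ h₀, satRight 1 (by norm_num) _ _ h₁]
  · rw [sat_or, sat_box, sat_box]
    -- All exchanged children have profile `e`, so membership in `e` decides `ψ` uniformly and
    -- selects the disjunct.
    by_cases hψe : ψ ∈ e
    · refine Or.inl fun r hr => ?_
      rw [sat_and, sat_imp, sat_imp]
      rcases glue_reach_child hab hr with ⟨x', rfl⟩ | ⟨y', rfl⟩
      · refine ⟨fun h => (satLeft 0 (by norm_num) _ _ h.1).2 ?_,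
          fun h => ((leftOnly _ _ rfl).2 h).elim⟩
        rw [← (leftOnly _ _ rfl).1.1 h, mem_profile] at hψe
        exact hψe.2
      · refine ⟨fun h => ((rightOnly _ _ rfl).2 h).elim,
          fun h => (satRight 1 (by norm_num) _ _ h.2).2 ?_⟩
        rw [← (rightOnly _ _ rfl).1.1 h, mem_profile] at hψe
        exact hψe.2
    · refine Or.inr fun r hr => ?_
      rw [sat_and, sat_imp, sat_imp, sat_neg, sat_neg]
      rcases glue_reach_child hab hr with ⟨x', rfl⟩ | ⟨y', rfl⟩
      · refine ⟨fun h => fun h' => ?_, fun h => ((leftOnly _ _ rfl).2 h).elim⟩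
        rw [← (leftOnly _ _ rfl).1.1 h, mem_profile] at hψe
        exact hψe ⟨hψ, (satLeft 0 (by norm_num) _ _ h.1).1 h'⟩
      · refine ⟨fun h => ((rightOnly _ _ rfl).2 h).elim, fun h h' => ?_⟩
        rw [← (rightOnly _ _ rfl).1.1 h, mem_profile] at hψe
        exact hψe ⟨hψ, (satRight 1 (by norm_num) _ _ h.2).1 h'⟩

end Swap

end GMLFormula

/-! ### Lowering the depth to zero, and the characterisation. -/

namespace AbstractModalLogic

open KripkeModel GMLFormula

variable {L : AbstractModalLogic.{u, v}}

theorem sat_of_gradedEquiv_succ (hL : L.Extends GML.{u}) (hU : L.UnravelingInvariant)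
    (hC : L.Compactness) (hS : L.LowenheimSkolem) (φ : L.Fml) (d : ℕ)
    (ih : ∀ (M N : KripkeModel.{u}) (a : M.World) (b : N.World), GradedEquiv M N (d + 1) a b →
      L.Sat φ M a → L.Sat φ N b)
    (M N : KripkeModel.{u}) (a : M.World) (b : N.World) (hab : GradedEquiv M N d a b)
    (ha : L.Sat φ M a) : L.Sat φ N b := by
  classical
  by_contra hb
  obtain ⟨θ, hθ⟩ := exists_distinguish φ
  obtain ⟨A, r, hA, hr, hax⟩ := exists_countable_of_finset hL hC hS
    θ (partAxioms d) <| by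
    intro s
    -- Here `c` is the set of classes already taken from `N`: for `∅` the hybrid behaves like `M`,
    -- and for `s.powerset`, which contains every profile, like `N`.
    obtain ⟨c, e, he, hc, hc'⟩ := Finset.exists_insert_of_not
      (p := fun c => L.Sat φ (hybrid M N (fun x => profile s M x ∉ c) fun y => profile s N y ∈ c)
        (.pair d a b)) (t := s.powerset)
      ((hU.sat_hybrid_left φ hab (by simp) (by simp)).2 ha)
      (fun h => hb ((hU.sat_hybrid_right φ hab (by simp [profile]) (by simp [profile])).1 h))
    refine ⟨swapModel M N s e c, .pair d a b, ?_, fun ψ hψ γ hγ =>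
      swapModel_partAxioms he hab hψ hγ⟩
    rw [hθ _ _ (glue_val_pair (by norm_num) _ _ _) (glue_val_pair (by norm_num) _ _ _),
      hU.sat_glue_part φ (by norm_num), hU.sat_glue_part φ (by norm_num)]
    exact ⟨hc, hc'⟩
  have hpq := hax (letter 0) _ (Or.inl ⟨0, Nat.zero_le d, rfl⟩)
  obtain ⟨h, h'⟩ := (hθ A r hpq.1 hpq.2).1 hr
  exact h' (ih _ _ _ _ (gradedEquiv_of_partAxioms hA hax hpq.1 hpq.2) h)

/-- Formulas of `L` do not distinguish worlds that are equivalent in graded modal logic. -/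
theorem sat_of_gml_equiv (hL : L.Extends GML.{u}) (hU : L.UnravelingInvariant)
    (hC : L.Compactness) (hS : L.LowenheimSkolem) (φ : L.Fml) (M N : KripkeModel.{u})
    (a : M.World) (b : N.World) (hab : ∀ ψ : GMLFormula, ψ.Sat M a ↔ ψ.Sat N b)
    (ha : L.Sat φ M a) : L.Sat φ N b := by
  obtain ⟨n, hn⟩ := exists_depth hL hU hC hS φ
  suffices H : ∀ (M N : KripkeModel.{u}) (a : M.World) (b : N.World), GradedEquiv M N 0 a b →
      L.Sat φ M a → L.Sat φ N b from H M N a b hab ha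
  induction n with
  | zero => exact hn
  | succ n ih => exact ih (sat_of_gradedEquiv_succ hL hU hC hS φ n hn)

/-- If no graded formula were equivalent to `φ`, two uses of compactness would produce
`GML`-equivalent points that disagree on `φ`. -/
theorem exists_gml_equivalent (hL : L.Extends GML.{u}) (hU : L.UnravelingInvariant)
    (hC : L.Compactness) (hS : L.LowenheimSkolem) (φ : L.Fml) :
    ∃ γ : GMLFormula, ∀ (M : KripkeModel.{u}) (a : M.World), L.Sat φ M a ↔ γ.Sat M a := by
  by_contra! hcon
  obtain ⟨φ', hφ'⟩ := L.closed_neg φ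
  -- A point refuting `φ` at which all graded consequences of `φ` hold.
  obtain ⟨N, b, -, hb, hN⟩ := exists_countable_of_finset hL hC hS φ'
    (fun γ : {γ : GMLFormula // ∀ (M : KripkeModel.{u}) (a : M.World),
      L.Sat φ M a → γ.Sat M a} => {γ.1}) <| by
    classical
    intro s
    obtain ⟨χ, hχ⟩ := exists_conj.{u} (s.image Subtype.val)
    obtain ⟨M, a, h⟩ := hcon χ
    have hφχ : L.Sat φ M a → χ.Sat M a := by
      intro h
      rw [hχ]
      intro ψ hψ
      obtain ⟨γ, -, rfl⟩ := Finset.mem_image.1 hψ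
      exact γ.2 M a h
    have : ¬ L.Sat φ M a ∧ χ.Sat M a := by tauto
    refine ⟨M, a, (hφ' M a).2 this.1, ?_⟩
    rintro γ hγ _ rfl
    exact (hχ M a).1 this.2 _ (Finset.mem_image_of_mem _ hγ)
  -- The graded theory of `b` is consistent with `φ`: otherwise the negation of a finite conjunction
  -- from it would be a consequence of `φ`, hence true at `b`.
  obtain ⟨M, a, -, ha, hM⟩ := exists_countable_of_finset hL hC hS φ
    (fun γ : {γ : GMLFormula // γ.Sat N b} => {γ.1}) <| by
    classical
    intro s
    obtain ⟨χ, hχ⟩ := exists_conj.{u} (s.image Subtype.val)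
    by_contra! hno
    have : ∀ (M : KripkeModel.{u}) (a : M.World), L.Sat φ M a → (neg χ).Sat M a := by
      intro M a h hc
      obtain ⟨γ, hγ, _, rfl, hn⟩ := hno M a h
      exact hn ((hχ M a).1 hc _ (Finset.mem_image_of_mem _ hγ))
    refine hN ⟨neg χ, this⟩ _ rfl ((hχ N b).2 fun ψ hψ => ?_)
    obtain ⟨γ, -, rfl⟩ := Finset.mem_image.1 hψ
    exact γ.2
  refine (hφ' N b).1 hb (sat_of_gml_equiv hL hU hC hS φ M N a b (fun ψ => ?_) ha)
  constructor
  · intro h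
    by_contra hn
    exact hM ⟨neg ψ, hn⟩ _ rfl h
  · exact fun h => hM ⟨ψ, h⟩ _ rfl

theorem ContainedIn.unravelingInvariant (h : L.ContainedIn GML.{u}) :
    L.UnravelingInvariant := by
  obtain ⟨f, hf⟩ := h
  intro φ M a
  rw [hf, hf]
  exact gml_unravelingInvariant (f φ) M a

/-- Serves for compactness and for Löwenheim–Skolem at once. -/
theorem ContainedIn.exists_countable (h : L.ContainedIn GML.{u}) (S : Set L.Fml)
    (hS : ∀ F ⊆ S, F.Finite → L.Satisfiable F) :
    ∃ (M : KripkeModel.{u}) (a : M.World), Countable M.World ∧ ∀ φ ∈ S, L.Sat φ M a := by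
  classical
  obtain ⟨f, hf⟩ := h
  obtain ⟨M, a, hM, hsat⟩ := GMLFormula.exists_countable_model.{u} (f '' S) <| by
    intro F hF hfin
    obtain ⟨G, hG, hGF⟩ := Finset.subset_set_image_iff.1
      (show (hfin.toFinset : Set GMLFormula) ⊆ f '' S by rwa [hfin.coe_toFinset])
    obtain ⟨M, a, h⟩ := hS G hG G.finite_toSet
    refine ⟨M, a, fun γ hγ => ?_⟩
    rw [← hfin.mem_toFinset, ← hGF] at hγ
    obtain ⟨φ, hφ, rfl⟩ := Finset.mem_image.1 hγ
    exact (hf φ M a).1 (h φ hφ)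
  exact ⟨M, a, hM, fun φ hφ => (hf φ M a).2 (hsat _ (Set.mem_image_of_mem f hφ))⟩

end AbstractModalLogic

theorem mainTheorem10 (L : AbstractModalLogic.{u, v}) (hL : L.Extends GML.{u}) :
    (L.UnravelingInvariant ∧ L.Compactness ∧ L.LowenheimSkolem) ↔
      L.ContainedIn GML.{u} := by
  constructor
  · rintro ⟨hU, hC, hS⟩
    choose f hf using AbstractModalLogic.exists_gml_equivalent hL hU hC hS
    exact ⟨f, hf⟩
  · intro h
    refine ⟨h.unravelingInvariant, fun S hS => ?_, fun S hS => ?_⟩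
    · obtain ⟨M, a, -, hsat⟩ := h.exists_countable S hS
      exact ⟨M, a, hsat⟩
    · obtain ⟨M, a, hsat⟩ := hS
      exact h.exists_countable S fun F hF _ => ⟨M, a, fun φ hφ => hsat φ (hF hφ)⟩
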